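/- A \emph{convex polyhedron} $P\subset\mathbb R^3$ is the convex hull of finitely many points, with nonempty interior; $V(P)$ and $F(P)$ are its numbers of vertices and of (two-dimensional) faces. Regard $P$ as a \emph{0-skeleton}: equal point masses are placed at its vertices, so that its centre of mass $c$ is the arithmetic mean of the vertices. A boundary point $q$ of $P$ is an \emph{equilibrium} if the plane $H$ through $q$ perpendicular to the segment $[c,q]$ supports $P$; it is \emph{nondegenerate} if $q$ lies in the relative interior of the vertex, edge or face $H\cap P$, and it is then called \emph{stable} if $H\cap P$ is a face and \emph{unstable} if $H\cap P$ is a vertex. Let $S(P)$ and $U(P)$ be the numbers of stable and unstable equilibria, and let the class $(S,U)$ consist of the convex polyhedra all of whose equilibria (as 0-skeletons) are nondegenerate and which have exactly $S$ stable and $U$ unstable ones. $P$ is \emph{mono-monostatic} if it is in the class $(1,1)$. Let $F_0^\star$ and $V_0^\star$ be the minimal numbers of faces and of vertices of a mono-monostatic 0-skeleton, and let $C^0(S,U)$ be the minimum of $C(P)=2\,(V(P)+F(P)-S(P)-U(P))$ over the class $(S,U)$. For $n\ge 1$, $k\ge 3$ and angles $\alpha_1,\dots,\alpha_n$, put $$r_i=\prod_{j=1}^{i}\cos\alpha_j,\qquad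 \theta_i=\sum_{j=1}^{i}\alpha_j,\qquad x_i=r_i\sin\theta_i,\qquad z_i=r_i\cos\theta_i\qquad(1\le i\le n).$$ The \emph{Conway $k$-spiral} $P_{n,k}$ is the convex hull of the point $\bigl(0,0,\,1+\sin^2\alpha_1\tan^2\tfrac{\pi}{k}\bigr)$ and the $kn$ points $$\Bigl(\tfrac{x_i}{\cos(\pi/k)}\cos\tfrac{2\pi m}{k},\ \tfrac{x_i}{\cos(\pi/k)}\sin\tfrac{2\pi m}{k},\ z_i\Bigr),\qquad 1\le i\le n,\ 0\le m<k.$$ \textbf{Theorem.} The Conway 5-spiral $P_{4,5}$ with $(\alpha_1,\alpha_2,\alpha_3,\alpha_4)=(66.173^\circ,\,44.519^\circ,\,29.875^\circ,\,19.716^\circ)$ is a convex polyhedron with exactly 21 vertices and 21 faces, and it is mono-monostatic as a 0-skeleton. Hence the minima $F_0^\star$ and $V_0^\star$ exist and $F_0^\star\le 21$, $V_0^\star\le 21$. Moreover the minimum $C^0(1,1)$ exists and $C^0(1,1)\le 2(21+21-1-1)=80$. -/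

import Mathlib

namespace ZeroSkeleton

noncomputable section

/-- Euclidean three-space. -/
abbrev E3 : Type := EuclideanSpace ℝ (Fin 3)

/-- A convex polyhedron: the convex hull of finitely many points, with nonempty interior. -/
def IsConvexPolyhedron (P : Set E3) : Prop :=
  (∃ s : Set E3, s.Finite ∧ P = convexHull ℝ s) ∧ (interior P).Nonempty

/-- The vertices of `P`. -/
def vertices (P : Set E3) : Set E3 := P.extremePoints ℝ

/-- The (two-dimensional) faces of `P`: its exposed subsets of dimension two. -/
def faces (P : Set E3) : Set (Set E3) :=
  {F | IsExposed ℝ P F ∧ Module.finrank ℝ (vectorSpan ℝ F) = 2}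

/-- The number of vertices. -/
def numVertices (P : Set E3) : ℕ := (vertices P).ncard

/-- The number of faces. -/
def numFaces (P : Set E3) : ℕ := (faces P).ncard

/-- The centre of mass of the polyhedral 0-skeleton: equal point masses at the vertices. -/
def centerOfMass (P : Set E3) : E3 :=
  (numVertices P : ℝ)⁻¹ • ∑ᶠ v ∈ vertices P, v

/-- `q` is an equilibrium point of `P` with respect to `c`: it lies on the boundary of `P`, and the
plane through `q` perpendicular to the segment from `c` to `q` supports `P` at `q`. -/
def IsEquilibrium (P : Set E3) (c q : E3) : Prop :=
  q ∈ frontier P ∧ ∀ x ∈ P, inner ℝ (x - q) (q - c) ≤ 0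

/-- The part of `P` in the plane through `q` perpendicular to the segment from `c` to `q`. -/
def contactSet (P : Set E3) (c q : E3) : Set E3 :=
  {x ∈ P | inner ℝ (x - q) (q - c) = 0}

/-- A nondegenerate equilibrium point: it lies in the relative interior of the vertex, edge or face
of `P` that the supporting plane touches. -/
def IsNondegenerateEquilibrium (P : Set E3) (c q : E3) : Prop :=
  IsEquilibrium P c q ∧ q ∈ intrinsicInterior ℝ (contactSet P c q)

/-- A stable equilibrium point: nondegenerate, and the supporting plane touches `P` in a face. -/
def IsStable (P : Set E3) (c q : E3) : Prop :=
  IsNondegenerateEquilibrium P c q ∧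
    Module.finrank ℝ (vectorSpan ℝ (contactSet P c q)) = 2

/-- An unstable equilibrium point: nondegenerate, and the supporting plane touches `P` in a
vertex. -/
def IsUnstable (P : Set E3) (c q : E3) : Prop :=
  IsNondegenerateEquilibrium P c q ∧
    Module.finrank ℝ (vectorSpan ℝ (contactSet P c q)) = 0

/-- The number of stable equilibria of the 0-skeleton. -/
def numStable (P : Set E3) : ℕ := {q | IsStable P (centerOfMass P) q}.ncard

/-- The number of unstable equilibria of the 0-skeleton. -/
def numUnstable (P : Set E3) : ℕ := {q | IsUnstable P (centerOfMass P) q}.ncard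

/-- The equilibrium class `(S, U)` of polyhedral 0-skeletons: the convex polyhedra, with equal point
masses at the vertices, all of whose equilibria are nondegenerate and which have exactly `S` stable
and `U` unstable ones. -/
def equilibriumClass (S U : ℕ) : Set (Set E3) :=
  {P | IsConvexPolyhedron P ∧
    (∀ q, IsEquilibrium P (centerOfMass P) q → IsNondegenerateEquilibrium P (centerOfMass P) q) ∧
    numStable P = S ∧ numUnstable P = U}

/-- The polyhedron `P`, as a 0-skeleton, is mono-monostatic. -/
def IsMonoMonostatic (P : Set E3) : Prop := P ∈ equilibriumClass 1 1

/-- The numbers of faces of mono-monostatic polyhedral 0-skeletons. -/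
def monoMonostaticFaceNumbers : Set ℕ := {f | ∃ P, IsMonoMonostatic P ∧ numFaces P = f}

/-- The numbers of vertices of mono-monostatic polyhedral 0-skeletons. -/
def monoMonostaticVertexNumbers : Set ℕ := {v | ∃ P, IsMonoMonostatic P ∧ numVertices P = v}

/-- The minimal number `F₀*` of faces of a mono-monostatic polyhedral 0-skeleton. -/
def minFaces : ℕ := sInf monoMonostaticFaceNumbers

/-- The minimal number `V₀*` of vertices of a mono-monostatic polyhedral 0-skeleton. -/
def minVertices : ℕ := sInf monoMonostaticVertexNumbers

/-- The mechanical complexity `2 (V + F - S - U)` of a polyhedral 0-skeleton. -/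
def complexity (P : Set E3) : ℤ :=
  2 * ((numVertices P : ℤ) + numFaces P - numStable P - numUnstable P)

/-- The complexities of the polyhedral 0-skeletons in the class `(S, U)`. -/
def classComplexities (S U : ℕ) : Set ℤ := complexity '' equilibriumClass S U

/-- The complexity `C⁰(S, U)` of the class `(S, U)`: the minimum of the complexities in it. -/
def classComplexity (S U : ℕ) : ℤ := sInf (classComplexities S U)

/-- The distance from the origin `O` to the point `P_i` of the Conway spiral with `P_0 = (0, 0, 1)`,
central angles `α_i = ∠ P_{i-1} O P_i` and right angles `∠ O P_i P_{i-1}`. -/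
def spiralRadius (α : ℕ → ℝ) (i : ℕ) : ℝ := ∏ j ∈ Finset.Icc 1 i, Real.cos (α j)

/-- The angle `∠ P_0 O P_i`. -/
def spiralAngle (α : ℕ → ℝ) (i : ℕ) : ℝ := ∑ j ∈ Finset.Icc 1 i, α j

/-- The `x`-coordinate of `P_i`. -/
def spiralX (α : ℕ → ℝ) (i : ℕ) : ℝ := spiralRadius α i * Real.sin (spiralAngle α i)

/-- The `z`-coordinate of `P_i`. -/
def spiralZ (α : ℕ → ℝ) (i : ℕ) : ℝ := spiralRadius α i * Real.cos (spiralAngle α i)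

/-- The top vertex `Q_0 = (0, 0, 1 + h)`, `h = sin² α₁ tan² (π / k)`, of the Conway `k`-spiral; the
edge from it to `Q_1` is perpendicular to `O Q_1`. -/
def topVertex (k : ℕ) (α : ℕ → ℝ) : E3 :=
  !₂[0, 0, 1 + Real.sin (α 1) ^ 2 * Real.tan (Real.pi / k) ^ 2]

/-- The `m`-th rotated copy of the vertex `Q_i` (`i ≥ 1`): it has the height of `P_i`, and the
distance `x_i / cos (π / k)` from the axis, so that `x_i` is the distance from the axis to the
sides of the regular `k`-gon formed by the copies. -/
def spiralVertex (k : ℕ) (α : ℕ → ℝ) (i m : ℕ) : E3 :=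
  !₂[spiralX α i / Real.cos (Real.pi / k) * Real.cos (2 * Real.pi * m / k),
    spiralX α i / Real.cos (Real.pi / k) * Real.sin (2 * Real.pi * m / k),
    spiralZ α i]

/-- The Conway `k`-spiral `P_{n,k}` with central angles `α_1, …, α_n`: the convex hull of the top
vertex and the `k` rotated copies of each of `Q_1, …, Q_n`. -/
def conwaySpiral (n k : ℕ) (α : ℕ → ℝ) : Set E3 :=
  convexHull ℝ ({topVertex k α} ∪
    {p | ∃ i m : ℕ, 1 ≤ i ∧ i ≤ n ∧ m < k ∧ p = spiralVertex k α i m})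

/-- The explicit central angles `α_1, …, α_4`, given in degrees and converted to radians: 66.173°,
44.519°, 29.875°, 19.716°. -/
def tableAngle : ℕ → ℝ
  | 1 => 66173 / 1000 * (Real.pi / 180)
  | 2 => 44519 / 1000 * (Real.pi / 180)
  | 3 => 29875 / 1000 * (Real.pi / 180)
  | 4 => 19716 / 1000 * (Real.pi / 180)
  | _ => 0

end

end ZeroSkeleton

open Real

/-! Write κ = cos (π/5), let O be the origin, and count levels downwards from the top vertex, which
is level 0. Along the profile, every step below level 1 is perpendicular to the ray from O to its
lower end; the height of the top vertex makes the actual edge from level 1 to the top perpendicular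
to the ray from O to its lower end as well. Seen from O, the distance is therefore stationary to
first order at each lower end. The centre of mass c lies on the axis strictly below O, at height
about -0.0154, so seen from c each upward step gains distance. This is the content of `level_ascent`
and `level_ascent_top`.

An equilibrium q lies on the face exposed in the direction u = q - c. Suppose u is not vertical and
take the lowest level touched by that face. Support says that the vertex directly above a touched
vertex of this level is no further in direction u. But q is a convex combination of touched
vertices, none of them lower, and the ascent inequalities are linear in the vertex, so they give the
opposite strict inequality at q. The passage from the profile to the pentagons uses that the maximum
of a linear functional over the vertices of a unit pentagon is between κ and 1 times its norm. On
the lower steps the apothem is the worst case, on the top edge the circumradius, whence the factor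
κ² there. Thus q is on the axis (`vertical_of_mem_exposedFace`): it is the top vertex, which is
unstable, or the centre of the bottom pentagon, which is stable.

For the faces, a two-dimensional exposed set in a non-vertical direction must touch two levels, and
two copies below the top; otherwise a second independent functional is constant on it. Two copies
force the horizontal part of the direction to be a side normal of the pentagon
(`exists_side_of_max`), and two levels force a side normal of the strictly convex profile
(`level_turn`, `exists_level_normal_of_max`). This leaves 4·5 side faces and the bottom. The 21
vertices are exposed by explicit functionals. All strict inequalities between coordinates are
checked on decimal enclosures. -/

/-! ### Decimal enclosures for the cosines and sines of the four angles -/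

lemma abs_mul_sub_le_of_abs_sub_le {x y a b c e f g : ℝ} (hx : |x - a| ≤ e) (hy : |y - b| ≤ f)
    (h : |a * b - c| + |a| * f + e * |b| + e * f ≤ g) : |x * y - c| ≤ g := by
  have he : 0 ≤ e := (abs_nonneg _).trans hx
  have h1 : x * y - c = (a * b - c) + a * (y - b) + (x - a) * b + (x - a) * (y - b) := by ring
  rw [h1]
  refine le_trans ?_ h
  refine (abs_add_le _ _).trans (add_le_add ((abs_add_le _ _).trans (add_le_add
    ((abs_add_le _ _).trans (add_le_add le_rfl ?_)) ?_)) ?_)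
  · rw [abs_mul]; gcongr
  · rw [abs_mul]; gcongr
  · rw [abs_mul]; gcongr

/-- The three terms of the error are the Taylor remainder, the rounding of the Taylor polynomial at
`a`, and the change of that polynomial between `a` and `x`. -/
lemma abs_cos_sub_le_of_abs_sub_le {x a c e g : ℝ} (hx : |x - a| ≤ e) (ha : |a| + e ≤ 1)
    (h : (|a| + e) ^ 4 * (5 / 96) + |1 - a ^ 2 / 2 - c| + (|a| + e) * e ≤ g) :
    |cos x - c| ≤ g := by
  have he : 0 ≤ e := (abs_nonneg _).trans hx
  have hxa : |x| ≤ |a| + e := by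
    have := abs_sub_abs_le_abs_sub x a
    linarith
  have h1 := cos_bound (hxa.trans ha)
  have h2 : |x| ^ 4 * (5 / 96) ≤ (|a| + e) ^ 4 * (5 / 96) := by gcongr
  have h3 : cos x - c = (cos x - (1 - x ^ 2 / 2)) + (1 - a ^ 2 / 2 - c)
      + ((x + a) / 2) * (a - x) := by ring
  have h4 : |((x + a) / 2) * (a - x)| ≤ (|a| + e) * e := by
    rw [abs_mul, abs_sub_comm a x]
    have : |(x + a) / 2| ≤ |a| + e := by
      rw [abs_div, abs_two]
      have := abs_add_le x a
      linarith
    gcongr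
  rw [h3]
  have := abs_add_three (cos x - (1 - x ^ 2 / 2)) (1 - a ^ 2 / 2 - c) (((x + a) / 2) * (a - x))
  linarith

lemma abs_sin_sub_le_of_abs_sub_le {x a c e g : ℝ} (hx : |x - a| ≤ e) (ha : |a| + e ≤ 1)
    (h : (|a| + e) ^ 5 / 100 + |a - a ^ 3 / 6 - c| + 2 * e ≤ g) :
    |sin x - c| ≤ g := by
  have he : 0 ≤ e := (abs_nonneg _).trans hx
  have hxa : |x| ≤ |a| + e := by
    have := abs_sub_abs_le_abs_sub x a
    linarith
  have h1 := sin_bound (hxa.trans ha)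
  have h2 : |x| ^ 5 / 100 ≤ (|a| + e) ^ 5 / 100 := by gcongr
  have h3 : sin x - c = (sin x - (x - x ^ 3 / 6)) + (a - a ^ 3 / 6 - c)
      + (1 - (x ^ 2 + x * a + a ^ 2) / 6) * (x - a) := by ring
  have h4 : |(1 - (x ^ 2 + x * a + a ^ 2) / 6) * (x - a)| ≤ 2 * e := by
    have hx1 : |x| ≤ 1 := hxa.trans ha
    have ha1 : |a| ≤ 1 := by linarith
    rw [abs_le] at hx1 ha1
    rw [abs_mul]
    have : |1 - (x ^ 2 + x * a + a ^ 2) / 6| ≤ 2 := by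
      rw [abs_le]
      constructor <;> nlinarith
    gcongr
  rw [h3]
  have := abs_add_three (sin x - (x - x ^ 3 / 6)) (a - a ^ 3 / 6 - c)
    ((1 - (x ^ 2 + x * a + a ^ 2) / 6) * (x - a))
  linarith

lemma abs_sqrt_sub_le {n a e : ℝ} (h1 : (a - e) ^ 2 ≤ n)
    (h2 : n ≤ (a + e) ^ 2) (h3 : 0 ≤ a + e) : |√n - a| ≤ e := by
  rw [abs_le]
  constructor
  · have := Real.le_sqrt_of_sq_le h1
    linarith
  · have := (Real.sqrt_le_left h3).2 h2
    linarith

lemma abs_mul_pi_div_sub_le {q a : ℝ} (hq : 0 ≤ q) (hq' : q ≤ 20)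
    (h : |q * (314159265 / 100000000 / 180) - a| ≤ 5 / 10000000) :
    |q * (π / 180) - a| ≤ 6 / 10000000 := by
  have h1 := pi_gt_d20
  have h2 := pi_lt_d20
  rw [abs_le] at *
  constructor <;> nlinarith

/-- Writing 66.173° = 60° + 6.173° leaves a remainder small enough for a short Taylor polynomial.
The other angles are 45° - 0.481°, 30° - 0.125° and 30° - 10.284°; the last remainder is the largest
and gives the coarsest bounds. -/
lemma cos_sin_angle_one :
    |cos (66173 / 1000 * (π / 180)) - 403976 / 1000000| ≤ 9 / 1000000 ∧
    |sin (66173 / 1000 * (π / 180)) - 914769 / 1000000| ≤ 14 / 1000000 := by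
  have h : |6173 / 1000 * (π / 180) - 107739 / 1000000| ≤ 6 / 10000000 :=
    abs_mul_pi_div_sub_le (by norm_num) (by norm_num) (by norm_num [abs_le])
  have hc : |cos (6173 / 1000 * (π / 180)) - 994196 / 1000000| ≤ 8 / 1000000 :=
    abs_cos_sub_le_of_abs_sub_le h (by norm_num [abs_of_pos]) (by norm_num [abs_of_pos, abs_of_neg])
  have hs : |sin (6173 / 1000 * (π / 180)) - 107531 / 1000000| ≤ 2 / 1000000 :=
    abs_sin_sub_le_of_abs_sub_le h (by norm_num [abs_of_pos]) (by norm_num [abs_of_pos, abs_of_neg])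
  have h3 : |√3 - 1732051 / 1000000| ≤ 1 / 1000000 :=
    abs_sqrt_sub_le (by norm_num) (by norm_num) (by norm_num)
  have hc3 : |√3 * cos (6173 / 1000 * (π / 180)) - 1721998 / 1000000| ≤ 16 / 1000000 :=
    abs_mul_sub_le_of_abs_sub_le h3 hc (by norm_num [abs_of_pos, abs_of_neg])
  have hs3 : |√3 * sin (6173 / 1000 * (π / 180)) - 186249 / 1000000| ≤ 5 / 1000000 :=
    abs_mul_sub_le_of_abs_sub_le h3 hs (by norm_num [abs_of_pos, abs_of_neg])
  have e : 66173 / 1000 * (π / 180) = π / 3 + 6173 / 1000 * (π / 180) := by ring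
  rw [e, cos_add, sin_add, cos_pi_div_three, sin_pi_div_three]
  simp only [abs_le] at *
  refine ⟨⟨?_, ?_⟩, ?_, ?_⟩ <;> linarith

lemma cos_sin_angle_two :
    |cos (44519 / 1000 * (π / 180)) - 713018 / 1000000| ≤ 5 / 1000000 ∧
    |sin (44519 / 1000 * (π / 180)) - 701146 / 1000000| ≤ 5 / 1000000 := by
  have h : |481 / 1000 * (π / 180) - 8395 / 1000000| ≤ 6 / 10000000 :=
    abs_mul_pi_div_sub_le (by norm_num) (by norm_num) (by norm_num [abs_le])
  have hc : |cos (481 / 1000 * (π / 180)) - 999965 / 1000000| ≤ 1 / 1000000 :=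
    abs_cos_sub_le_of_abs_sub_le h (by norm_num [abs_of_pos]) (by norm_num [abs_of_pos, abs_of_neg])
  have hs : |sin (481 / 1000 * (π / 180)) - 8395 / 1000000| ≤ 2 / 1000000 :=
    abs_sin_sub_le_of_abs_sub_le h (by norm_num [abs_of_pos]) (by norm_num [abs_of_pos, abs_of_neg])
  have h2 : |√2 - 1414214 / 1000000| ≤ 1 / 1000000 :=
    abs_sqrt_sub_le (by norm_num) (by norm_num) (by norm_num)
  have hc2 : |√2 * cos (481 / 1000 * (π / 180)) - 1414164 / 1000000| ≤ 4 / 1000000 :=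
    abs_mul_sub_le_of_abs_sub_le h2 hc (by norm_num [abs_of_pos, abs_of_neg])
  have hs2 : |√2 * sin (481 / 1000 * (π / 180)) - 11872 / 1000000| ≤ 4 / 1000000 :=
    abs_mul_sub_le_of_abs_sub_le h2 hs (by norm_num [abs_of_pos, abs_of_neg])
  have e : 44519 / 1000 * (π / 180) = π / 4 - 481 / 1000 * (π / 180) := by ring
  rw [e, cos_sub, sin_sub, cos_pi_div_four, sin_pi_div_four]
  simp only [abs_le] at *
  refine ⟨⟨?_, ?_⟩, ?_, ?_⟩ <;> linarith

lemma cos_sin_angle_three :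
    |cos (29875 / 1000 * (π / 180)) - 867114 / 1000000| ≤ 5 / 1000000 ∧
    |sin (29875 / 1000 * (π / 180)) - 498109 / 1000000| ≤ 5 / 1000000 := by
  have h : |125 / 1000 * (π / 180) - 2182 / 1000000| ≤ 6 / 10000000 :=
    abs_mul_pi_div_sub_le (by norm_num) (by norm_num) (by norm_num [abs_le])
  have hc : |cos (125 / 1000 * (π / 180)) - 999998 / 1000000| ≤ 1 / 1000000 :=
    abs_cos_sub_le_of_abs_sub_le h (by norm_num [abs_of_pos]) (by norm_num [abs_of_pos, abs_of_neg])
  have hs : |sin (125 / 1000 * (π / 180)) - 2182 / 1000000| ≤ 2 / 1000000 :=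
    abs_sin_sub_le_of_abs_sub_le h (by norm_num [abs_of_pos]) (by norm_num [abs_of_pos, abs_of_neg])
  have h3 : |√3 - 1732051 / 1000000| ≤ 1 / 1000000 :=
    abs_sqrt_sub_le (by norm_num) (by norm_num) (by norm_num)
  have hc3 : |√3 * cos (125 / 1000 * (π / 180)) - 1732047 / 1000000| ≤ 4 / 1000000 :=
    abs_mul_sub_le_of_abs_sub_le h3 hc (by norm_num [abs_of_pos, abs_of_neg])
  have hs3 : |√3 * sin (125 / 1000 * (π / 180)) - 3779 / 1000000| ≤ 5 / 1000000 :=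
    abs_mul_sub_le_of_abs_sub_le h3 hs (by norm_num [abs_of_pos, abs_of_neg])
  have e : 29875 / 1000 * (π / 180) = π / 6 - 125 / 1000 * (π / 180) := by ring
  rw [e, cos_sub, sin_sub, cos_pi_div_six, sin_pi_div_six]
  simp only [abs_le] at *
  refine ⟨⟨?_, ?_⟩, ?_, ?_⟩ <;> linarith

lemma cos_sin_angle_four :
    |cos (19716 / 1000 * (π / 180)) - 941339 / 1000000| ≤ 55 / 1000000 ∧
    |sin (19716 / 1000 * (π / 180)) - 337336 / 1000000| ≤ 35 / 1000000 := by
  have h : |10284 / 1000 * (π / 180) - 179490 / 1000000| ≤ 6 / 10000000 :=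
    abs_mul_pi_div_sub_le (by norm_num) (by norm_num) (by norm_num [abs_le])
  have hc : |cos (10284 / 1000 * (π / 180)) - 983892 / 1000000| ≤ 56 / 1000000 :=
    abs_cos_sub_le_of_abs_sub_le h (by norm_num [abs_of_pos]) (by norm_num [abs_of_pos, abs_of_neg])
  have hs : |sin (10284 / 1000 * (π / 180)) - 178527 / 1000000| ≤ 4 / 1000000 :=
    abs_sin_sub_le_of_abs_sub_le h (by norm_num [abs_of_pos]) (by norm_num [abs_of_pos, abs_of_neg])
  have h3 : |√3 - 1732051 / 1000000| ≤ 1 / 1000000 :=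
    abs_sqrt_sub_le (by norm_num) (by norm_num) (by norm_num)
  have hc3 : |√3 * cos (10284 / 1000 * (π / 180)) - 1704151 / 1000000| ≤ 99 / 1000000 :=
    abs_mul_sub_le_of_abs_sub_le h3 hc (by norm_num [abs_of_pos, abs_of_neg])
  have hs3 : |√3 * sin (10284 / 1000 * (π / 180)) - 309218 / 1000000| ≤ 8 / 1000000 :=
    abs_mul_sub_le_of_abs_sub_le h3 hs (by norm_num [abs_of_pos, abs_of_neg])
  have e : 19716 / 1000 * (π / 180) = π / 6 - 10284 / 1000 * (π / 180) := by ring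
  rw [e, cos_sub, sin_sub, cos_pi_div_six, sin_pi_div_six]
  simp only [abs_le] at *
  refine ⟨⟨?_, ?_⟩, ?_, ?_⟩ <;> linarith

namespace ZeroSkeleton

/-! ### Decimal enclosures for the profile of the spiral -/

lemma spiralRadius_succ (α : ℕ → ℝ) (i : ℕ) :
    spiralRadius α (i + 1) = spiralRadius α i * cos (α (i + 1)) := by
  unfold spiralRadius
  rw [Finset.prod_Icc_succ_top (by omega)]

lemma spiralAngle_succ (α : ℕ → ℝ) (i : ℕ) :
    spiralAngle α (i + 1) = spiralAngle α i + α (i + 1) := by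
  unfold spiralAngle
  rw [Finset.sum_Icc_succ_top (by omega)]

lemma spiral_bounds_one :
    |spiralRadius tableAngle 1 - 403976 / 1000000| ≤ 9 / 1000000 ∧
    |cos (spiralAngle tableAngle 1) - 403976 / 1000000| ≤ 9 / 1000000 ∧
    |sin (spiralAngle tableAngle 1) - 914769 / 1000000| ≤ 14 / 1000000 := by
  have hr : spiralRadius tableAngle 1 = cos (66173 / 1000 * (π / 180)) := by
    simp [spiralRadius, tableAngle]
  have ha : spiralAngle tableAngle 1 = 66173 / 1000 * (π / 180) := by
    simp [spiralAngle, tableAngle]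
  rw [hr, ha]
  exact ⟨cos_sin_angle_one.1, cos_sin_angle_one⟩

lemma spiral_bounds_two :
    |spiralRadius tableAngle 2 - 288042 / 1000000| ≤ 9 / 1000000 ∧
    |cos (spiralAngle tableAngle 2) - -353344 / 1000000| ≤ 25 / 1000000 ∧
    |sin (spiralAngle tableAngle 2) - 935493 / 1000000| ≤ 25 / 1000000 := by
  obtain ⟨hr, hc, hs⟩ := spiral_bounds_one
  obtain ⟨hc', hs'⟩ := cos_sin_angle_two
  rw [spiralRadius_succ, spiralAngle_succ, cos_add, sin_add]
  simp only [tableAngle]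
  refine ⟨abs_mul_sub_le_of_abs_sub_le hr hc' (by norm_num [abs_of_pos, abs_of_neg]), ?_, ?_⟩
  · have h1 := abs_mul_sub_le_of_abs_sub_le (c := 288042 / 1000000) (g := 9 / 1000000) hc hc'
      (by norm_num [abs_of_pos, abs_of_neg])
    have h2 := abs_mul_sub_le_of_abs_sub_le (c := 641387 / 1000000) (g := 15 / 1000000) hs hs'
      (by norm_num [abs_of_pos, abs_of_neg])
    rw [abs_le] at *
    constructor <;> linarith
  · have h1 := abs_mul_sub_le_of_abs_sub_le (c := 652247 / 1000000) (g := 15 / 1000000) hs hc'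
      (by norm_num [abs_of_pos, abs_of_neg])
    have h2 := abs_mul_sub_le_of_abs_sub_le (c := 283246 / 1000000) (g := 9 / 1000000) hc hs'
      (by norm_num [abs_of_pos, abs_of_neg])
    rw [abs_le] at *
    constructor <;> linarith

lemma spiral_bounds_three :
    |spiralRadius tableAngle 3 - 249765 / 1000000| ≤ 10 / 1000000 ∧
    |cos (spiralAngle tableAngle 3) - -772367 / 1000000| ≤ 46 / 1000000 ∧
    |sin (spiralAngle tableAngle 3) - 635175 / 1000000| ≤ 46 / 1000000 := by
  obtain ⟨hr, hc, hs⟩ := spiral_bounds_two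
  obtain ⟨hc', hs'⟩ := cos_sin_angle_three
  rw [spiralRadius_succ, spiralAngle_succ, cos_add, sin_add]
  simp only [tableAngle]
  refine ⟨abs_mul_sub_le_of_abs_sub_le hr hc' (by norm_num [abs_of_pos, abs_of_neg]), ?_, ?_⟩
  · have h1 := abs_mul_sub_le_of_abs_sub_le (c := -306390 / 1000000) (g := 24 / 1000000) hc hc'
      (by norm_num [abs_of_pos, abs_of_neg])
    have h2 := abs_mul_sub_le_of_abs_sub_le (c := 465977 / 1000000) (g := 18 / 1000000) hs hs'
      (by norm_num [abs_of_pos, abs_of_neg])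
    rw [abs_le] at *
    constructor <;> linarith
  · have h1 := abs_mul_sub_le_of_abs_sub_le (c := 811179 / 1000000) (g := 28 / 1000000) hs hc'
      (by norm_num [abs_of_pos, abs_of_neg])
    have h2 := abs_mul_sub_le_of_abs_sub_le (c := -176004 / 1000000) (g := 15 / 1000000) hc hs'
      (by norm_num [abs_of_pos, abs_of_neg])
    rw [abs_le] at *
    constructor <;> linarith

lemma spiral_bounds_four :
    |spiralRadius tableAngle 4 - 235114 / 1000000| ≤ 25 / 1000000 ∧
    |cos (spiralAngle tableAngle 4) - -941327 / 1000000| ≤ 130 / 1000000 ∧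
    |sin (spiralAngle tableAngle 4) - 337367 / 1000000| ≤ 130 / 1000000 := by
  obtain ⟨hr, hc, hs⟩ := spiral_bounds_three
  obtain ⟨hc', hs'⟩ := cos_sin_angle_four
  rw [spiralRadius_succ, spiralAngle_succ, cos_add, sin_add]
  simp only [tableAngle]
  refine ⟨abs_mul_sub_le_of_abs_sub_le hr hc' (by norm_num [abs_of_pos, abs_of_neg]), ?_, ?_⟩
  · have h1 := abs_mul_sub_le_of_abs_sub_le (c := -727059 / 1000000) (g := 88 / 1000000) hc hc'
      (by norm_num [abs_of_pos, abs_of_neg])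
    have h2 := abs_mul_sub_le_of_abs_sub_le (c := 214267 / 1000000) (g := 40 / 1000000) hs hs'
      (by norm_num [abs_of_pos, abs_of_neg])
    rw [abs_le] at *
    constructor <;> linarith
  · have h1 := abs_mul_sub_le_of_abs_sub_le (c := 597915 / 1000000) (g := 80 / 1000000) hs hc'
      (by norm_num [abs_of_pos, abs_of_neg])
    have h2 := abs_mul_sub_le_of_abs_sub_le (c := -260547 / 1000000) (g := 45 / 1000000) hc hs'
      (by norm_num [abs_of_pos, abs_of_neg])
    rw [abs_le] at *
    constructor <;> linarith

/-- The apothems of the pentagonal levels, the top vertex being level `0`. -/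
noncomputable def levelX (i : Fin 5) : ℝ := spiralX tableAngle i

/-- The heights of the pentagonal levels, the top vertex being level `0`. -/
noncomputable def levelZ (i : Fin 5) : ℝ :=
  if i = 0 then 1 + sin (tableAngle 1) ^ 2 * tan (π / 5) ^ 2 else spiralZ tableAngle i

lemma levelX_zero : levelX 0 = 0 := by
  simp [levelX, spiralX, spiralAngle]

lemma levelX_one : |levelX 1 - 369545 / 1000000| ≤ 20 / 1000000 := by
  obtain ⟨hr, -, hs⟩ := spiral_bounds_one
  exact abs_mul_sub_le_of_abs_sub_le hr hs (by norm_num [abs_of_pos, abs_of_neg])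

lemma levelX_two : |levelX 2 - 269462 / 1000000| ≤ 20 / 1000000 := by
  obtain ⟨hr, -, hs⟩ := spiral_bounds_two
  exact abs_mul_sub_le_of_abs_sub_le hr hs (by norm_num [abs_of_pos, abs_of_neg])

lemma levelX_three : |levelX 3 - 158645 / 1000000| ≤ 20 / 1000000 := by
  obtain ⟨hr, -, hs⟩ := spiral_bounds_three
  exact abs_mul_sub_le_of_abs_sub_le hr hs (by norm_num [abs_of_pos, abs_of_neg])

lemma levelX_four : |levelX 4 - 79320 / 1000000| ≤ 45 / 1000000 := by
  obtain ⟨hr, -, hs⟩ := spiral_bounds_four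
  exact abs_mul_sub_le_of_abs_sub_le hr hs (by norm_num [abs_of_pos, abs_of_neg])

lemma levelZ_one : |levelZ 1 - 163197 / 1000000| ≤ 10 / 1000000 := by
  obtain ⟨hr, hc, -⟩ := spiral_bounds_one
  exact abs_mul_sub_le_of_abs_sub_le hr hc (by norm_num [abs_of_pos, abs_of_neg])

lemma levelZ_two : |levelZ 2 - -101778 / 1000000| ≤ 20 / 1000000 := by
  obtain ⟨hr, hc, -⟩ := spiral_bounds_two
  exact abs_mul_sub_le_of_abs_sub_le hr hc (by norm_num [abs_of_pos, abs_of_neg])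

lemma levelZ_three : |levelZ 3 - -192911 / 1000000| ≤ 21 / 1000000 := by
  obtain ⟨hr, hc, -⟩ := spiral_bounds_three
  exact abs_mul_sub_le_of_abs_sub_le hr hc (by norm_num [abs_of_pos, abs_of_neg])

lemma levelZ_four : |levelZ 4 - -221319 / 1000000| ≤ 60 / 1000000 := by
  obtain ⟨hr, hc, -⟩ := spiral_bounds_four
  exact abs_mul_sub_le_of_abs_sub_le hr hc (by norm_num [abs_of_pos, abs_of_neg])

lemma levelZ_zero : |levelZ 0 - 1441718 / 1000000| ≤ 30 / 1000000 := by
  -- The exact value of tan² 36° reduces the enclosure to one of √5.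
  have h : tan (π / 5) ^ 2 = 5 - 2 * √5 := by
    have h5 : (√5) ^ 2 = 5 := sq_sqrt (by norm_num)
    have hc : cos (π / 5) ≠ 0 := by
      rw [cos_pi_div_five]; positivity
    rw [tan_eq_sin_div_cos, div_pow, sin_sq, div_eq_iff (pow_ne_zero 2 hc), cos_pi_div_five]
    nlinarith
  have h5 : |√5 - 2236068 / 1000000| ≤ 1 / 1000000 :=
    abs_sqrt_sub_le (by norm_num) (by norm_num) (by norm_num)
  have hs := cos_sin_angle_one.2
  have h1 := abs_mul_sub_le_of_abs_sub_le (c := 836802 / 1000000) (g := 27 / 1000000) hs hs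
    (by norm_num [abs_of_pos, abs_of_neg])
  have h2 : |5 - 2 * √5 - 527864 / 1000000| ≤ 2 / 1000000 := by
    rw [abs_le] at *
    constructor <;> linarith
  have h3 := abs_mul_sub_le_of_abs_sub_le (c := 441718 / 1000000) (g := 18 / 1000000) h1 h2
    (by norm_num [abs_of_pos, abs_of_neg])
  simp only [levelZ, if_true, tableAngle, h, sq (sin _)]
  rw [abs_le] at *
  constructor <;> linarith

/-! ### Linear functionals on the regular pentagon -/

/-- Cosine of the `m`-th vertex direction of the regular pentagon. -/
noncomputable def pentC (m : Fin 5) : ℝ := cos (2 * π * (m : ℕ) / (5 : ℕ))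

/-- Sine of the `m`-th vertex direction of the regular pentagon. -/
noncomputable def pentS (m : Fin 5) : ℝ := sin (2 * π * (m : ℕ) / (5 : ℕ))

lemma pent_angle_add (m d : Fin 5) :
    2 * π * ((m + d : Fin 5) : ℕ) / (5 : ℕ) =
      2 * π * (m : ℕ) / (5 : ℕ) + 2 * π * (d : ℕ) / (5 : ℕ)
        - (((m : ℕ) + d) / 5 : ℕ) * (2 * π) := by
  have h : (((m : ℕ) + d) % 5 : ℕ) + 5 * (((m : ℕ) + d) / 5 : ℕ) = (m : ℕ) + d :=
    Nat.mod_add_div _ _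
  have h' : ((((m : ℕ) + d) % 5 : ℕ) : ℝ) + 5 * ((((m : ℕ) + d) / 5 : ℕ) : ℝ) = (m : ℕ) + (d : ℕ) :=
    mod_cast h
  rw [Fin.val_add]
  push_cast at h' ⊢
  linear_combination (2 * π / 5) * h'

lemma pentC_add (m d : Fin 5) : pentC (m + d) = pentC m * pentC d - pentS m * pentS d := by
  simp only [pentC, pentS, pent_angle_add, cos_sub_nat_mul_two_pi, cos_add]

lemma pentS_add (m d : Fin 5) : pentS (m + d) = pentS m * pentC d + pentC m * pentS d := by
  simp only [pentC, pentS, pent_angle_add, sin_sub_nat_mul_two_pi, sin_add]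

lemma pentC_sq_add_pentS_sq (m : Fin 5) : pentC m ^ 2 + pentS m ^ 2 = 1 := by
  simp [pentC, pentS]

/-- This quadratic equation for κ, together with sin² + cos² = 1, turns the pentagon identities into
polynomial algebra. It also says κ + 1/2 = 2κ². -/
lemma four_mul_cos_pi_div_five_sq : 4 * cos (π / 5) ^ 2 = 2 * cos (π / 5) + 1 := by
  have h5 : (√5) ^ 2 = 5 := sq_sqrt (by norm_num)
  rw [cos_pi_div_five]
  nlinarith

lemma abs_cos_pi_div_five : |cos (π / 5) - 809017 / 1000000| ≤ 1 / 1000000 := by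
  have h5 : |√5 - 2236068 / 1000000| ≤ 1 / 1000000 :=
    abs_sqrt_sub_le (by norm_num) (by norm_num) (by norm_num)
  rw [cos_pi_div_five]
  rw [abs_le] at *
  constructor <;> linarith

lemma cos_pi_div_five_pos : 0 < cos (π / 5) := by
  rw [cos_pi_div_five]; positivity

lemma sin_pi_div_five_pos : 0 < sin (π / 5) :=
  sin_pos_of_pos_of_lt_pi (by positivity) (by linarith [pi_pos])

@[simp] lemma pentC_zero : pentC 0 = 1 := by simp [pentC]

@[simp] lemma pentS_zero : pentS 0 = 0 := by simp [pentS]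

lemma pentC_one : pentC 1 = cos (π / 5) - 1 / 2 := by
  have : 2 * π * ((1 : Fin 5) : ℕ) / (5 : ℕ) = 2 * (π / 5) := by norm_num; ring
  rw [pentC, this, cos_two_mul]
  linarith [four_mul_cos_pi_div_five_sq]

lemma pentS_one : pentS 1 = 2 * sin (π / 5) * cos (π / 5) := by
  have : 2 * π * ((1 : Fin 5) : ℕ) / (5 : ℕ) = 2 * (π / 5) := by norm_num; ring
  rw [pentS, this, sin_two_mul]

lemma pentC_two : pentC 2 = -cos (π / 5) := by
  have : 2 * π * ((2 : Fin 5) : ℕ) / (5 : ℕ) = π - π / 5 := by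
    norm_num [Fin.val_two]; ring
  rw [pentC, this, cos_pi_sub]

lemma pentS_two : pentS 2 = sin (π / 5) := by
  have : 2 * π * ((2 : Fin 5) : ℕ) / (5 : ℕ) = π - π / 5 := by
    norm_num [Fin.val_two]; ring
  rw [pentS, this, sin_pi_sub]

lemma pentC_three : pentC 3 = -cos (π / 5) := by
  have : 2 * π * ((3 : Fin 5) : ℕ) / (5 : ℕ) = π / 5 + π := by
    have : ((3 : Fin 5) : ℕ) = 3 := rfl
    rw [this]; push_cast; ring
  rw [pentC, this, cos_add_pi]

lemma pentS_three : pentS 3 = -sin (π / 5) := by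
  have : 2 * π * ((3 : Fin 5) : ℕ) / (5 : ℕ) = π / 5 + π := by
    have : ((3 : Fin 5) : ℕ) = 3 := rfl
    rw [this]; push_cast; ring
  rw [pentS, this, sin_add_pi]

lemma pentC_four : pentC 4 = cos (π / 5) - 1 / 2 := by
  have : 2 * π * ((4 : Fin 5) : ℕ) / (5 : ℕ) = 2 * π - 2 * (π / 5) := by
    have : ((4 : Fin 5) : ℕ) = 4 := rfl
    rw [this]; push_cast; ring
  rw [pentC, this, cos_two_pi_sub, cos_two_mul]
  linarith [four_mul_cos_pi_div_five_sq]

lemma pentS_four : pentS 4 = -(2 * sin (π / 5) * cos (π / 5)) := by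
  have : 2 * π * ((4 : Fin 5) : ℕ) / (5 : ℕ) = 2 * π - 2 * (π / 5) := by
    have : ((4 : Fin 5) : ℕ) = 4 := rfl
    rw [this]; push_cast; ring
  rw [pentS, this, sin_two_pi_sub, sin_two_mul]

lemma pentC_lt_one {d : Fin 5} (hd : d ≠ 0) : pentC d < 1 := by
  have h := abs_le.1 abs_cos_pi_div_five
  fin_cases d
  · exact absurd rfl hd
  · change pentC 1 < 1; rw [pentC_one]; linarith
  · change pentC 2 < 1; rw [pentC_two]; linarith
  · change pentC 3 < 1; rw [pentC_three]; linarith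
  · change pentC 4 < 1; rw [pentC_four]; linarith

lemma pent_sub (m n : Fin 5) : pentC m * pentC n + pentS m * pentS n = pentC (n - m) := by
  have h1 := pentC_add m (n - m)
  have h2 := pentS_add m (n - m)
  rw [add_sub_cancel] at h1 h2
  rw [h1, h2]
  linear_combination pentC (n - m) * pentC_sq_add_pentS_sq m

lemma sum_pentC : ∑ m, pentC m = 0 := by
  rw [Fin.sum_univ_five, pentC_zero, pentC_one, pentC_two, pentC_three, pentC_four]; ring

lemma sum_pentS : ∑ m, pentS m = 0 := by
  rw [Fin.sum_univ_five, pentS_zero, pentS_one, pentS_two, pentS_three, pentS_four]; ring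

lemma sum_pentC_sq : ∑ m, pentC m * pentC m = 5 / 2 := by
  rw [Fin.sum_univ_five, pentC_zero, pentC_one, pentC_two, pentC_three, pentC_four]
  linear_combination four_mul_cos_pi_div_five_sq

lemma sum_pentC_mul_pentS : ∑ m, pentC m * pentS m = 0 := by
  rw [Fin.sum_univ_five, pentC_zero, pentC_one, pentC_two, pentC_three, pentC_four,
    pentS_zero, pentS_one, pentS_two, pentS_three, pentS_four]
  ring

lemma sum_pentS_sq : ∑ m, pentS m * pentS m = 5 / 2 := by
  have h : ∑ m, pentC m * pentC m + ∑ m, pentS m * pentS m = 5 := by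
    rw [← Finset.sum_add_distrib]
    simp only [← sq, pentC_sq_add_pentS_sq]
    simp
  rw [sum_pentC_sq] at h
  linarith

/-- The linear functional `(a, b)` at the `m`-th vertex of the unit pentagon. -/
noncomputable def pentVal (a b : ℝ) (m : Fin 5) : ℝ := a * pentC m + b * pentS m

lemma sum_pentVal (a b : ℝ) : ∑ m, pentVal a b m = 0 := by
  simp only [pentVal, Finset.sum_add_distrib, ← Finset.mul_sum, sum_pentC, sum_pentS]
  ring

lemma pentVal_add (a b : ℝ) (m d : Fin 5) :
    pentVal a b (m + d) =
      pentVal a b m * pentC d + (b * pentC m - a * pentS m) * pentS d := by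
  simp only [pentVal, pentC_add, pentS_add]
  ring

lemma pentVal_sq_add (a b : ℝ) (m : Fin 5) :
    pentVal a b m ^ 2 + (b * pentC m - a * pentS m) ^ 2 = a ^ 2 + b ^ 2 := by
  rw [pentVal]
  linear_combination (a ^ 2 + b ^ 2) * pentC_sq_add_pentS_sq m

lemma pentVal_sq_le (a b : ℝ) (m : Fin 5) : pentVal a b m ^ 2 ≤ a ^ 2 + b ^ 2 := by
  have := pentVal_sq_add a b m
  nlinarith [sq_nonneg (b * pentC m - a * pentS m)]

/-- Relative to vertex `m`, the functional has a radial component p and a tangential component q.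
Its values at the two neighbours are p cos 72° ± q sin 72°; that neither exceeds p bounds |q|. -/
lemma pent_skew_le_of_max {a b : ℝ} {m : Fin 5} (h : ∀ n, pentVal a b n ≤ pentVal a b m) :
    2 * sin (π / 5) * cos (π / 5) * |b * pentC m - a * pentS m| ≤
      pentVal a b m * (3 / 2 - cos (π / 5)) := by
  have h1 := h (m + 1)
  have h4 := h (m + 4)
  rw [pentVal_add, pentC_one, pentS_one] at h1
  rw [pentVal_add, pentC_four, pentS_four] at h4
  rcases abs_cases (b * pentC m - a * pentS m) with ⟨e, -⟩ | ⟨e, -⟩ <;> rw [e] <;> linarith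

lemma pentVal_nonneg_of_max {a b : ℝ} {m : Fin 5} (h : ∀ n, pentVal a b n ≤ pentVal a b m) :
    0 ≤ pentVal a b m := by
  have h1 := pent_skew_le_of_max h
  have h2 : 0 ≤ 2 * sin (π / 5) * cos (π / 5) * |b * pentC m - a * pentS m| := by
    have := cos_pi_div_five_pos
    have := sin_pi_div_five_pos
    positivity
  have := abs_le.1 abs_cos_pi_div_five
  exact nonneg_of_mul_nonneg_left (h2.trans h1) (by linarith)

/-- A maximum over the vertices of the pentagon is at least the inradius bound. -/
lemma cos_sq_mul_le_of_max {a b : ℝ} {m : Fin 5} (h : ∀ n, pentVal a b n ≤ pentVal a b m) :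
    cos (π / 5) ^ 2 * (a ^ 2 + b ^ 2) ≤ pentVal a b m ^ 2 := by
  have h1 := pent_skew_le_of_max h
  have hc := cos_pi_div_five_pos
  have hs := sin_pi_div_five_pos
  have hk := four_mul_cos_pi_div_five_sq
  have h2 := sin_sq_add_cos_sq (π / 5)
  rw [← pentVal_sq_add a b m]
  set p := pentVal a b m
  set q := b * pentC m - a * pentS m
  set c := cos (π / 5)
  set s := sin (π / 5)
  have h3 : (2 * s * c * |q|) ^ 2 ≤ (p * (3 / 2 - c)) ^ 2 := by gcongr
  have h4 : (2 * s * c * |q|) ^ 2 = 4 * s ^ 2 * (c ^ 2 * q ^ 2) := by rw [mul_pow, sq_abs]; ring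
  have h5 : (p * (3 / 2 - c)) ^ 2 = 4 * s ^ 2 * (s ^ 2 * p ^ 2) := by
    have hs2 : s ^ 2 = 1 - c ^ 2 := by linarith
    -- Here 3/2 - c = 1 - cos 72° = 2 sin² 36°, so the bound on q is |q| ≤ p tan 36°.
    have : (3 / 2 - c) ^ 2 = 4 * (1 - c ^ 2) * (1 - c ^ 2) := by
      linear_combination (-c ^ 2 - c / 2 + 7 / 4) * hk
    rw [mul_pow, this, hs2]; ring
  rw [h4, h5] at h3
  have h6 : c ^ 2 * q ^ 2 ≤ s ^ 2 * p ^ 2 := le_of_mul_le_mul_left h3 (by positivity)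
  have : s ^ 2 * p ^ 2 = p ^ 2 - c ^ 2 * p ^ 2 := by
    linear_combination p ^ 2 * h2
  linarith

lemma pentVal_pos_of_max {a b : ℝ} (hab : ¬ (a = 0 ∧ b = 0)) {m : Fin 5}
    (h : ∀ n, pentVal a b n ≤ pentVal a b m) : 0 < pentVal a b m := by
  refine lt_of_le_of_ne (pentVal_nonneg_of_max h) fun h0 => hab ?_
  have h1 := cos_sq_mul_le_of_max h
  rw [← h0] at h1
  have hc := cos_pi_div_five_pos
  have h2 : a ^ 2 + b ^ 2 ≤ 0 := by
    by_contra! hlt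
    have : 0 < cos (π / 5) ^ 2 * (a ^ 2 + b ^ 2) := by positivity
    linarith
  constructor <;> nlinarith [sq_nonneg a, sq_nonneg b]

/-- The outward normal of the side of the pentagon from vertex `m` to vertex `m + 1`. -/
noncomputable def sideC (m : Fin 5) : ℝ := pentC m + pentC (m + 1)

/-- The outward normal of the side of the pentagon from vertex `m` to vertex `m + 1`. -/
noncomputable def sideS (m : Fin 5) : ℝ := pentS m + pentS (m + 1)

lemma pentVal_side (m n : Fin 5) :
    pentVal (sideC m) (sideS m) n = pentC (n - m) + pentC (n - m - 1) := by
  rw [pentVal, sideC, sideS, sub_sub, ← pent_sub m n, ← pent_sub (m + 1) n]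
  ring

lemma pentVal_side_left (m : Fin 5) :
    pentVal (sideC m) (sideS m) m = cos (π / 5) + 1 / 2 := by
  rw [pentVal_side, sub_self, zero_sub, show (-1 : Fin 5) = 4 from rfl, pentC_zero, pentC_four]
  ring

lemma pentVal_side_right (m : Fin 5) :
    pentVal (sideC m) (sideS m) (m + 1) = cos (π / 5) + 1 / 2 := by
  rw [pentVal_side, add_sub_cancel_left, sub_self, pentC_zero, pentC_one]
  ring

lemma pentVal_side_lt {m n : Fin 5} (h1 : n ≠ m) (h2 : n ≠ m + 1) :
    pentVal (sideC m) (sideS m) n < cos (π / 5) + 1 / 2 := by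
  rw [pentVal_side]
  have hk := abs_le.1 abs_cos_pi_div_five
  obtain ⟨d, rfl⟩ : ∃ d, n = m + d := ⟨n - m, by simp⟩
  rw [add_sub_cancel_left]
  fin_cases d
  · simp at h1
  · simp at h2
  · change pentC 2 + pentC 1 < _
    rw [pentC_two, pentC_one]; linarith
  · change pentC 3 + pentC 2 < _
    rw [pentC_two, pentC_three]; linarith
  · change pentC 4 + pentC 3 < _
    rw [pentC_four, pentC_three]; linarith

lemma pentVal_side_le (m n : Fin 5) :
    pentVal (sideC m) (sideS m) n ≤ cos (π / 5) + 1 / 2 := by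
  by_cases h1 : n = m
  · rw [h1, pentVal_side_left]
  by_cases h2 : n = m + 1
  · rw [h2, pentVal_side_right]
  exact (pentVal_side_lt h1 h2).le

/-- A nonzero functional with two maximal vertices is a positive multiple of a side normal. -/
lemma exists_side_of_max {a b : ℝ} (hab : ¬ (a = 0 ∧ b = 0)) {m n : Fin 5} (hmn : m ≠ n)
    (h : ∀ l, pentVal a b l ≤ pentVal a b m) (hn : pentVal a b n = pentVal a b m) :
    ∃ k : Fin 5, ∃ t : ℝ, 0 < t ∧ a = t * sideC k ∧ b = t * sideS k := by
  have hp := pentVal_pos_of_max hab h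
  have h1 := pent_skew_le_of_max h
  have hc := abs_le.1 abs_cos_pi_div_five
  have hc0 := cos_pi_div_five_pos
  have hs := sin_pi_div_five_pos
  have hk := four_mul_cos_pi_div_five_sq
  have h2 := sin_sq_add_cos_sq (π / 5)
  have hm := pentC_sq_add_pentS_sq m
  obtain ⟨d, rfl⟩ : ∃ d, n = m + d := ⟨n - m, by simp⟩
  rw [pentVal_add] at hn
  have ha : a = pentVal a b m * pentC m - (b * pentC m - a * pentS m) * pentS m := by
    rw [pentVal]; linear_combination -a * hm
  have hb : b = pentVal a b m * pentS m + (b * pentC m - a * pentS m) * pentC m := by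
    rw [pentVal]; linear_combination -b * hm
  generalize pentVal a b m = p at *
  generalize b * pentC m - a * pentS m = q at *
  have hq1 := mul_le_mul_of_nonneg_left (le_abs_self q)
    (by positivity : 0 ≤ 2 * sin (π / 5) * cos (π / 5))
  have hq2 := mul_le_mul_of_nonneg_left (neg_le_abs q)
    (by positivity : 0 ≤ 2 * sin (π / 5) * cos (π / 5))
  have ht : 0 < cos (π / 5) + 1 / 2 := by positivity
  -- This is sin² 72° = (1 - cos 72°)(1 + cos 72°).
  have key : (2 * sin (π / 5) * cos (π / 5)) ^ 2 =
      (3 / 2 - cos (π / 5)) * (cos (π / 5) + 1 / 2) := by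
    linear_combination 4 * cos (π / 5) ^ 2 * h2 + (3 / 4 - cos (π / 5) ^ 2 - cos (π / 5) / 2) * hk
  have hsc : 2 * sin (π / 5) * cos (π / 5) ≠ 0 := by positivity
  fin_cases d
  · simp at hmn
  · change p * pentC 1 + q * pentS 1 = p at hn
    rw [pentC_one, pentS_one] at hn
    have hq : q * (cos (π / 5) + 1 / 2) = 2 * sin (π / 5) * cos (π / 5) * p := by
      apply mul_left_cancel₀ hsc
      linear_combination (cos (π / 5) + 1 / 2) * hn - p * key
    refine ⟨m, p / (cos (π / 5) + 1 / 2), by positivity, ?_, ?_⟩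
    · rw [sideC, pentC_add, pentC_one, pentS_one, ha, div_mul_eq_mul_div, eq_div_iff ht.ne']
      linear_combination -pentS m * hq
    · rw [sideS, pentS_add, pentC_one, pentS_one, hb, div_mul_eq_mul_div, eq_div_iff ht.ne']
      linear_combination pentC m * hq
  -- A tie with a non-adjacent vertex would need a tangential component larger than the neighbours
  -- allow.
  · change p * pentC 2 + q * pentS 2 = p at hn
    rw [pentC_two, pentS_two] at hn
    nlinarith
  · change p * pentC 3 + q * pentS 3 = p at hn
    rw [pentC_three, pentS_three] at hn
    nlinarith
  · change p * pentC 4 + q * pentS 4 = p at hn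
    rw [pentC_four, pentS_four] at hn
    have hq : q * (cos (π / 5) + 1 / 2) = -(2 * sin (π / 5) * cos (π / 5) * p) := by
      apply mul_left_cancel₀ hsc
      linear_combination -(cos (π / 5) + 1 / 2) * hn + p * key
    have hm4 : m + 4 + 1 = m := by rw [add_assoc, show (4 + 1 : Fin 5) = 0 from rfl, add_zero]
    refine ⟨m + 4, p / (cos (π / 5) + 1 / 2), by positivity, ?_, ?_⟩
    · rw [sideC, hm4, pentC_add, pentC_four, pentS_four, ha, div_mul_eq_mul_div,
        eq_div_iff ht.ne']
      linear_combination -pentS m * hq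
    · rw [sideS, hm4, pentS_add, pentC_four, pentS_four, hb, div_mul_eq_mul_div,
        eq_div_iff ht.ne']
      linear_combination pentC m * hq

/-! ### Convexity of the profile and ascent away from the centre of mass -/

/-- Decimal approximations of the apothems. -/
noncomputable def approxX : Fin 5 → ℝ :=
  ![0, 369545 / 1000000, 269462 / 1000000, 158645 / 1000000, 79320 / 1000000]

/-- Decimal approximations of the heights. -/
noncomputable def approxZ : Fin 5 → ℝ :=
  ![1441718 / 1000000, 163197 / 1000000, -101778 / 1000000, -192911 / 1000000,
    -221319 / 1000000]

lemma approxX_castSucc (i : Fin 4) : approxX i.castSucc =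
    ![0, 369545 / 1000000, 269462 / 1000000, 158645 / 1000000] i := by
  fin_cases i <;> rfl

lemma approxX_succ (i : Fin 4) : approxX i.succ =
    ![369545 / 1000000, 269462 / 1000000, 158645 / 1000000, 79320 / 1000000] i := by
  fin_cases i <;> rfl

lemma approxZ_castSucc (i : Fin 4) : approxZ i.castSucc =
    ![1441718 / 1000000, 163197 / 1000000, -101778 / 1000000, -192911 / 1000000] i := by
  fin_cases i <;> rfl

lemma approxZ_succ (i : Fin 4) : approxZ i.succ =
    ![163197 / 1000000, -101778 / 1000000, -192911 / 1000000, -221319 / 1000000] i := by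
  fin_cases i <;> rfl

lemma levelX_approx (i : Fin 5) : |levelX i - approxX i| ≤ 60 / 1000000 := by
  fin_cases i
  · norm_num [levelX_zero, approxX]
  · exact levelX_one.trans (by norm_num)
  · exact levelX_two.trans (by norm_num)
  · exact levelX_three.trans (by norm_num)
  · exact levelX_four.trans (by norm_num)

lemma levelZ_approx (i : Fin 5) : |levelZ i - approxZ i| ≤ 60 / 1000000 := by
  fin_cases i
  · exact levelZ_zero.trans (by norm_num)
  · exact levelZ_one.trans (by norm_num)
  · exact levelZ_two.trans (by norm_num)
  · exact levelZ_three.trans (by norm_num)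
  · exact levelZ_four.trans (by norm_num)

lemma abs_sub_sub_le {x y a b e f : ℝ} (hx : |x - a| ≤ e) (hy : |y - b| ≤ f) :
    |x - y - (a - b)| ≤ e + f := by
  rw [show x - y - (a - b) = (x - a) - (y - b) by ring]
  exact (abs_sub _ _).trans (add_le_add hx hy)

lemma mul_add_mul_pos_of_approx {A B C D a b c d e : ℝ} (hA : |A - a| ≤ e) (hB : |B - b| ≤ e)
    (hC : |C - c| ≤ e) (hD : |D - d| ≤ e)
    (h : e * (|a| + |b| + |c| + |d|) + 2 * e ^ 2 < a * b + c * d) : 0 < A * B + C * D := by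
  have h1 := abs_mul_sub_le_of_abs_sub_le (c := a * b) hA hB le_rfl
  have h2 := abs_mul_sub_le_of_abs_sub_le (c := c * d) hC hD le_rfl
  rw [sub_self, abs_zero] at h1 h2
  have h3 := (abs_le.1 h1).1
  have h4 := (abs_le.1 h2).1
  linarith

lemma levelZ_strictAnti : StrictAnti levelZ := by
  refine Fin.strictAnti_iff_succ_lt.2 fun i => ?_
  have h1 := abs_le.1 (levelZ_approx i.castSucc)
  have h2 := abs_le.1 (levelZ_approx i.succ)
  have : approxZ i.succ + 120 / 1000000 < approxZ i.castSucc := by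
    rw [approxZ_succ, approxZ_castSucc]
    fin_cases i <;> norm_num
  linarith

lemma levelX_pos {i : Fin 5} (hi : i ≠ 0) : 0 < levelX i := by
  have h1 := abs_le.1 (levelX_approx i)
  have : 60 / 1000000 < approxX i := by
    fin_cases i
    · exact absurd rfl hi
    all_goals norm_num [approxX]
  linarith

/-- The profile of the spiral turns strictly to the same side. -/
lemma level_turn {i k j : Fin 5} (hik : i < k) (hkj : k < j) :
    0 < (levelX k - levelX i) * (levelZ i - levelZ j)
      + (levelZ k - levelZ i) * (levelX j - levelX i) := by
  refine mul_add_mul_pos_of_approx (abs_sub_sub_le (levelX_approx k) (levelX_approx i))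
    (abs_sub_sub_le (levelZ_approx i) (levelZ_approx j))
    (abs_sub_sub_le (levelZ_approx k) (levelZ_approx i))
    (abs_sub_sub_le (levelX_approx j) (levelX_approx i)) ?_
  fin_cases i <;> fin_cases k <;> first | (exfalso; revert hik; decide) | skip
  all_goals fin_cases j <;> first | (exfalso; revert hkj; decide) | skip
  all_goals norm_num [approxX, approxZ, abs_of_pos, abs_of_neg]

/-- Slopes of supporting lines that touch the profile in one level only. -/
def supportSlope : Fin 5 → ℝ := ![1, 0, -1, -2, -5]

lemma level_support_lt {i j : Fin 5} (hi : i ≠ 0) (hij : j ≠ i) :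
    levelX j + supportSlope i * levelZ j < levelX i + supportSlope i * levelZ i := by
  have h1 := abs_le.1 (levelX_approx i)
  have h2 := abs_le.1 (levelX_approx j)
  have h3 := abs_le.1 (levelZ_approx i)
  have h4 := abs_le.1 (levelZ_approx j)
  fin_cases i <;> first | exact absurd rfl hi | skip
  all_goals fin_cases j <;> first | exact absurd rfl hij | skip
  all_goals
    norm_num [approxX, approxZ, supportSlope] at h1 h2 h3 h4 ⊢
    linarith

/-- The height of the centre of mass. -/
noncomputable def centerZ : ℝ :=
  (levelZ 0 + 5 * (levelZ 1 + levelZ 2 + levelZ 3 + levelZ 4)) / 21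

/-- The negative sign is what matters: with O in place of the centre of mass, the ascent
inequalities at the lower end of each step would be equalities. -/
lemma centerZ_approx : |centerZ - -15352 / 1000000| ≤ 60 / 1000000 := by
  have h0 := abs_le.1 levelZ_zero
  have h1 := abs_le.1 levelZ_one
  have h2 := abs_le.1 levelZ_two
  have h3 := abs_le.1 levelZ_three
  have h4 := abs_le.1 levelZ_four
  rw [centerZ, abs_le]
  constructor <;> linarith

lemma levelZ_four_lt_centerZ : levelZ 4 < centerZ := by
  have h1 := abs_le.1 centerZ_approx
  have h4 := abs_le.1 levelZ_four
  linarith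

lemma centerZ_lt_levelZ_zero : centerZ < levelZ 0 := by
  have h1 := abs_le.1 centerZ_approx
  have h4 := abs_le.1 levelZ_zero
  linarith

/-- Below the first level, moving up the spiral increases the distance from the centre of mass,
as seen from every level further up. -/
lemma level_ascent {i : Fin 4} (hi : i ≠ 0) {j : Fin 5} (hj : j ≤ i.succ) :
    levelX i.succ ≤ levelX i.castSucc ∧
    0 < levelX j * (levelX i.castSucc - levelX i.succ)
      + (levelZ j - centerZ) * (levelZ i.castSucc - levelZ i.succ) := by
  have hX := abs_sub_sub_le (levelX_approx i.castSucc) (levelX_approx i.succ)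
  constructor
  · have h1 := abs_le.1 hX
    have : 120 / 1000000 ≤ approxX i.castSucc - approxX i.succ := by
      rw [approxX_succ, approxX_castSucc]
      fin_cases i <;> first | exact absurd rfl hi | norm_num
    linarith
  · refine mul_add_mul_pos_of_approx ((levelX_approx j).trans (by norm_num)) hX
      (abs_sub_sub_le (levelZ_approx j) centerZ_approx)
      (abs_sub_sub_le (levelZ_approx i.castSucc) (levelZ_approx i.succ)) ?_
    rw [approxX_succ, approxX_castSucc, approxZ_succ, approxZ_castSucc]
    fin_cases i <;> first | exact absurd rfl hi | skip
    all_goals fin_cases j <;> first | (exfalso; revert hj; decide) | skip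
    all_goals norm_num [approxX, approxZ, abs_of_pos, abs_of_neg]

/-- The ascent from the first level to the top vertex, along an edge of the polyhedron. -/
lemma level_ascent_top {j : Fin 5} (hj : j ≤ 1) :
    0 < levelX j * (levelX 0 - levelX 1)
      + (levelZ j - centerZ) * (levelZ 0 - levelZ 1) * cos (π / 5) ^ 2 := by
  have hk := abs_cos_pi_div_five
  have h2 : |cos (π / 5) ^ 2 - 654508 / 1000000| ≤ 3 / 1000000 := by
    rw [sq]
    exact abs_mul_sub_le_of_abs_sub_le hk hk (by norm_num [abs_of_pos, abs_of_neg])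
  have hZ : |levelZ 0 - levelZ 1 - 1278521 / 1000000| ≤ 40 / 1000000 := by
    have h0 := abs_le.1 levelZ_zero
    have h1 := abs_le.1 levelZ_one
    rw [abs_le]
    constructor <;> linarith
  have h3 : |(levelZ 0 - levelZ 1) * cos (π / 5) ^ 2 - 836802 / 1000000| ≤ 120 / 1000000 :=
    abs_mul_sub_le_of_abs_sub_le hZ h2 (by norm_num [abs_of_pos, abs_of_neg])
  rw [mul_assoc]
  refine mul_add_mul_pos_of_approx ((levelX_approx j).trans (by norm_num))
    (abs_sub_sub_le (levelX_approx 0) (levelX_approx 1))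
    (abs_sub_sub_le (levelZ_approx j) centerZ_approx) (h3.trans (by norm_num)) ?_
  fin_cases j <;> first | (exfalso; revert hj; decide) | skip
  all_goals norm_num [approxX, approxZ, abs_of_pos, abs_of_neg]

/-- A functional on the profile with two maximal levels is a positive multiple of the normal of a
side of the profile. -/
lemma exists_level_normal_of_max {t w : ℝ} (ht : 0 < t) {i j : Fin 5} (hij : i < j)
    (h : ∀ k, t * levelX k + w * levelZ k ≤ t * levelX i + w * levelZ i)
    (hj : t * levelX j + w * levelZ j = t * levelX i + w * levelZ i) :
    ∃ l : Fin 4, ∃ s : ℝ, 0 < s ∧ t = s * (levelZ l.castSucc - levelZ l.succ) ∧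
      w = s * (levelX l.succ - levelX l.castSucc) := by
  have hZ : 0 < levelZ i - levelZ j := sub_pos.2 (levelZ_strictAnti hij)
  obtain ⟨l, rfl⟩ : ∃ l : Fin 4, i = l.castSucc :=
    ⟨i.castPred (hij.trans_le (Fin.le_last j)).ne, by simp⟩
  have hlj : l.succ ≤ j := Fin.castSucc_lt_iff_succ_le.1 hij
  rcases hlj.eq_or_lt with rfl | hlt
  · refine ⟨l, t / (levelZ l.castSucc - levelZ l.succ), by positivity, ?_, ?_⟩
    · field_simp
    · rw [div_mul_eq_mul_div, eq_div_iff hZ.ne']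
      linarith
  -- A skipped level in between would lie strictly beyond the line through levels `l` and `j`,
  -- against maximality.
  · exfalso
    have h1 := level_turn Fin.castSucc_lt_succ hlt
    have h2 := h l.succ
    have h3 := mul_pos ht h1
    have h4 : w * (levelZ l.castSucc - levelZ j) = t * (levelX j - levelX l.castSucc) := by
      linarith
    have h5 : 0 < (t * (levelX l.succ - levelX l.castSucc)
        + w * (levelZ l.succ - levelZ l.castSucc)) * (levelZ l.castSucc - levelZ j) := by
      refine h3.trans_eq ?_
      linear_combination -(levelZ l.succ - levelZ l.castSucc) * h4
    have h6 := pos_of_mul_pos_left h5 hZ.le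
    linarith

lemma level_normal_lt (l : Fin 4) (j : Fin 5) (hj : j ≠ l.castSucc) (hj' : j ≠ l.succ) :
    (levelZ l.castSucc - levelZ l.succ) * levelX j
        + (levelX l.succ - levelX l.castSucc) * levelZ j
      < (levelZ l.castSucc - levelZ l.succ) * levelX l.castSucc
        + (levelX l.succ - levelX l.castSucc) * levelZ l.castSucc := by
  rcases lt_or_gt_of_ne hj with h | h
  · have := level_turn h (Fin.castSucc_lt_succ (i := l))
    linarith
  · have h2 : l.succ < j := lt_of_le_of_ne (Fin.castSucc_lt_iff_succ_le.1 h) hj'.symm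
    have := level_turn (Fin.castSucc_lt_succ (i := l)) h2
    linarith

end ZeroSkeleton

/-! ### Convex hulls, maximisers and dimension -/

/-- The open half-space `l < l y` together with the hull of the maximisers is convex and contains
`s`, hence contains `y`; and `y` is not in the open half-space. -/
lemma mem_convexHull_inter_of_isMax {E : Type*} [AddCommGroup E] [Module ℝ E] (l : E →ₗ[ℝ] ℝ)
    {s : Set E} {y : E} (hs : ∀ x ∈ s, l x ≤ l y) (hy : y ∈ convexHull ℝ s) :
    y ∈ convexHull ℝ (s ∩ {x | l x = l y}) := by
  set t := convexHull ℝ (s ∩ {x | l x = l y})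
  have htl : ∀ x ∈ t, l x = l y := by
    have : Convex ℝ {x | l x = l y} := convex_hyperplane l.isLinear (l y)
    intro x hx
    exact convexHull_min Set.inter_subset_right this hx
  have hconv : Convex ℝ ({x | l x < l y} ∪ t) := by
    rw [convex_iff_forall_pos]
    intro x hx z hz a b ha hb hab
    by_cases hxz : x ∈ t ∧ z ∈ t
    · exact Or.inr (convex_convexHull ℝ _ hxz.1 hxz.2 ha.le hb.le hab)
    · left
      have hle : ∀ v ∈ {x | l x < l y} ∪ t, l v ≤ l y := by
        rintro v (hv | hv)
        · exact le_of_lt hv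
        · exact (htl v hv).le
      have hx' := hle x hx
      have hz' := hle z hz
      have hlt : l x < l y ∨ l z < l y := by
        rcases hx with hx | hx
        · exact Or.inl hx
        · rcases hz with hz | hz
          · exact Or.inr hz
          · exact absurd ⟨hx, hz⟩ hxz
      simp only [Set.mem_ofPred_eq, map_add, map_smul, smul_eq_mul]
      have hb' : b = 1 - a := by linarith
      subst hb'
      rcases hlt with h | h <;> nlinarith
  have hsub : s ⊆ {x | l x < l y} ∪ t := by
    intro x hx
    rcases (hs x hx).lt_or_eq with h | h
    · exact Or.inl h
    · exact Or.inr (subset_convexHull ℝ _ ⟨hx, h⟩)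
  rcases convexHull_min hsub hconv hy with h | h
  · exact (lt_irrefl (l y) h).elim
  · exact h

lemma notMem_interior_of_isMax {E : Type*} [NormedAddCommGroup E] [InnerProductSpace ℝ E]
    {P : Set E} {u x : E} (hu : u ≠ 0) (h : ∀ y ∈ P, inner ℝ u y ≤ inner ℝ u x) :
    x ∉ interior P := by
  intro hx
  have hmax : IsLocalMax (innerSL ℝ u) x := by
    filter_upwards [mem_interior_iff_mem_nhds.1 hx] with y hy
    simpa using h y hy
  have h0 := hmax.hasFDerivAt_eq_zero (innerSL ℝ u).hasFDerivAt
  have h1 : innerSL ℝ u u = 0 := by rw [h0]; rfl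
  rw [innerSL_apply_apply] at h1
  exact hu (inner_self_eq_zero.1 h1)

lemma vectorSpan_convexHull {E : Type*} [AddCommGroup E] [Module ℝ E] (s : Set E) :
    vectorSpan ℝ (convexHull ℝ s) = vectorSpan ℝ s := by
  rw [← direction_affineSpan, affineSpan_convexHull, direction_affineSpan]

lemma vectorSpan_le_orthogonal_span {E : Type*} [NormedAddCommGroup E] [InnerProductSpace ℝ E]
    {s t : Set E} (h : ∀ n ∈ t, ∀ x ∈ s, ∀ y ∈ s, inner ℝ n x = inner ℝ n y) :
    vectorSpan ℝ s ≤ (Submodule.span ℝ t)ᗮ := by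
  rw [vectorSpan_def, Submodule.span_le]
  rintro _ ⟨x, hx, y, hy, rfl⟩
  rw [SetLike.mem_coe, Submodule.mem_orthogonal]
  intro v hv
  induction hv using Submodule.span_induction with
  | mem n hn => simp only [vsub_eq_sub, inner_sub_right, h n hn x hx y hy, sub_self]
  | zero => simp
  | add a b _ _ ha hb => rw [inner_add_left, ha, hb, add_zero]
  | smul c a _ ha => rw [inner_smul_left, ha, mul_zero]

/-- Each functional constant on `s` is orthogonal to its direction space, so independent ones cut
the dimension by one each. -/
lemma finrank_vectorSpan_add_le {E : Type*} [NormedAddCommGroup E] [InnerProductSpace ℝ E]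
    [FiniteDimensional ℝ E] {s : Set E} {k : ℕ} {n : Fin k → E} (hn : LinearIndependent ℝ n)
    (h : ∀ i, ∀ x ∈ s, ∀ y ∈ s, inner ℝ (n i) x = inner ℝ (n i) y) :
    Module.finrank ℝ (vectorSpan ℝ s) + k ≤ Module.finrank ℝ E := by
  have h1 : vectorSpan ℝ s ≤ (Submodule.span ℝ (Set.range n))ᗮ :=
    vectorSpan_le_orthogonal_span (by rintro _ ⟨i, rfl⟩; exact h i)
  have h2 := Submodule.finrank_mono h1
  have h3 := Submodule.finrank_add_finrank_orthogonal (Submodule.span ℝ (Set.range n))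
  rw [finrank_span_eq_card hn, Fintype.card_fin] at h3
  omega

lemma two_le_finrank_vectorSpan {E : Type*} [NormedAddCommGroup E] [InnerProductSpace ℝ E]
    [FiniteDimensional ℝ E] {s : Set E} {x y z : E} (hx : x ∈ s) (hy : y ∈ s) (hz : z ∈ s)
    (h : LinearIndependent ℝ ![y - x, z - x]) :
    2 ≤ Module.finrank ℝ (vectorSpan ℝ s) := by
  have h1 : Submodule.span ℝ (Set.range ![y - x, z - x]) ≤ vectorSpan ℝ s := by
    rw [Submodule.span_le]
    rintro _ ⟨i, rfl⟩
    fin_cases i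
    · exact vsub_mem_vectorSpan ℝ hy hx
    · exact vsub_mem_vectorSpan ℝ hz hx
  have h2 := Submodule.finrank_mono h1
  rwa [finrank_span_eq_card h, Fintype.card_fin] at h2

namespace ZeroSkeleton

/-! ### The polyhedron, its exposed faces and its 21 vertices -/

/-- The vertices of the spiral polyhedron: `m` numbers the copies in level `i`. -/
noncomputable def spiralPoint (i m : Fin 5) : E3 :=
  !₂[levelX i / cos (π / 5) * pentC m, levelX i / cos (π / 5) * pentS m, levelZ i]

@[simp] lemma spiralPoint_apply_zero (i m : Fin 5) :
    spiralPoint i m 0 = levelX i / cos (π / 5) * pentC m := rfl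

@[simp] lemma spiralPoint_apply_one (i m : Fin 5) :
    spiralPoint i m 1 = levelX i / cos (π / 5) * pentS m := rfl

@[simp] lemma spiralPoint_apply_two (i m : Fin 5) : spiralPoint i m 2 = levelZ i := rfl

lemma spiralPoint_zero (m : Fin 5) : spiralPoint 0 m = spiralPoint 0 0 := by
  simp [spiralPoint, levelX_zero]

/-- All the vertices of the spiral polyhedron. -/
def spiralPoints : Set E3 := {v | ∃ i m, v = spiralPoint i m}

lemma spiralPoints_eq_range :
    spiralPoints = Set.range fun p : Fin 5 × Fin 5 => spiralPoint p.1 p.2 := by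
  ext v
  simp only [spiralPoints, Set.mem_ofPred_eq, Set.mem_range, Prod.exists, eq_comm]

lemma spiralPoints_finite : spiralPoints.Finite := by
  rw [spiralPoints_eq_range]
  exact Set.finite_range _

lemma spiralPoint_eq_spiralVertex {i : Fin 5} (hi : i ≠ 0) (m : Fin 5) :
    spiralPoint i m = spiralVertex 5 tableAngle i m := by
  simp only [spiralPoint, spiralVertex, levelX, levelZ, if_neg hi, pentC, pentS, Nat.cast_ofNat]

lemma spiralPoint_zero_eq_topVertex (m : Fin 5) :
    spiralPoint 0 m = topVertex 5 tableAngle := by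
  simp [spiralPoint, levelX_zero, topVertex, levelZ]

/-- The explicit Conway 5-spiral. -/
def spiral : Set E3 := convexHull ℝ spiralPoints

lemma conwaySpiral_eq_spiral : conwaySpiral 4 5 tableAngle = spiral := by
  rw [conwaySpiral, spiral]
  congr 1
  ext v
  constructor
  · rintro (rfl | ⟨i, m, hi, hi', hm, rfl⟩)
    · exact ⟨0, 0, (spiralPoint_zero_eq_topVertex 0).symm⟩
    · have h0 : (⟨i, by omega⟩ : Fin 5) ≠ 0 := by
        intro h
        rw [Fin.ext_iff] at h
        change i = 0 at h
        omega
      refine ⟨⟨i, by omega⟩, ⟨m, hm⟩, ?_⟩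
      rw [spiralPoint_eq_spiralVertex h0]
  · rintro ⟨i, m, rfl⟩
    by_cases hi : i = 0
    · left
      rw [hi]
      exact spiralPoint_zero_eq_topVertex m
    · right
      have h1 : (i : ℕ) ≠ 0 := fun h => hi (Fin.ext h)
      refine ⟨i, m, by omega, by omega, m.2, ?_⟩
      rw [spiralPoint_eq_spiralVertex hi]

lemma inner_eq (u v : E3) : inner ℝ u v = u 0 * v 0 + u 1 * v 1 + u 2 * v 2 := by
  simp [PiLp.inner_apply, Fin.sum_univ_three, mul_comm]

lemma inner_spiralPoint (u : E3) (i m : Fin 5) :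
    inner ℝ u (spiralPoint i m) =
      levelX i / cos (π / 5) * pentVal (u 0) (u 1) m + levelZ i * u 2 := by
  rw [inner_eq, pentVal, spiralPoint_apply_zero, spiralPoint_apply_one, spiralPoint_apply_two]
  ring

lemma E3_ext {u v : E3} (h0 : u 0 = v 0) (h1 : u 1 = v 1) (h2 : u 2 = v 2) : u = v := by
  ext i
  fin_cases i <;> assumption

lemma spiralPoint_mem (i m : Fin 5) : spiralPoint i m ∈ spiral :=
  subset_convexHull ℝ _ ⟨i, m, rfl⟩

lemma isClosed_spiral : IsClosed spiral :=
  (spiralPoints_finite.isCompact_convexHull ℝ).isClosed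

/-- The exposed subset of the spiral polyhedron in direction `u`. -/
def exposedFace (u : E3) : Set E3 := {x ∈ spiral | ∀ y ∈ spiral, inner ℝ u y ≤ inner ℝ u x}

lemma inner_le_of_forall_spiralPoint {u x : E3}
    (h : ∀ i m, inner ℝ u (spiralPoint i m) ≤ inner ℝ u x) :
    ∀ y ∈ spiral, inner ℝ u y ≤ inner ℝ u x := by
  have hc : Convex ℝ {y : E3 | inner ℝ u y ≤ inner ℝ u x} :=
    convex_halfSpace_le (innerₛₗ ℝ u).isLinear _
  have : spiralPoints ⊆ {y : E3 | inner ℝ u y ≤ inner ℝ u x} := by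
    rintro _ ⟨i, m, rfl⟩
    exact h i m
  exact fun y hy => convexHull_min this hc hy

lemma mem_exposedFace_iff {u x : E3} : x ∈ exposedFace u ↔
    x ∈ spiral ∧ ∀ i m, inner ℝ u (spiralPoint i m) ≤ inner ℝ u x :=
  ⟨fun h => ⟨h.1, fun i m => h.2 _ (spiralPoint_mem i m)⟩,
    fun h => ⟨h.1, inner_le_of_forall_spiralPoint h.2⟩⟩

lemma inner_eq_of_mem_exposedFace {u x y : E3} (hx : x ∈ exposedFace u) (hy : y ∈ exposedFace u) :
    inner ℝ u x = inner ℝ u y :=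
  le_antisymm (hy.2 x hx.1) (hx.2 y hy.1)

lemma mem_convexHull_of_mem_exposedFace {u x : E3} (hx : x ∈ exposedFace u) :
    x ∈ convexHull ℝ {v | ∃ i m, v = spiralPoint i m ∧ spiralPoint i m ∈ exposedFace u} := by
  have h := mem_convexHull_inter_of_isMax (innerₛₗ ℝ u) (s := spiralPoints) (y := x)
    (fun y hy => hx.2 y (subset_convexHull ℝ _ hy)) hx.1
  refine convexHull_mono ?_ h
  rintro _ ⟨⟨i, m, rfl⟩, hv⟩
  refine ⟨i, m, rfl, spiralPoint_mem i m, fun y hy => ?_⟩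
  have hv' : inner ℝ u (spiralPoint i m) = inner ℝ u x := hv
  rw [hv']
  exact hx.2 y hy

/-- A linear inequality that holds at the vertices of an exposed face holds on the face. -/
lemma inner_lt_of_mem_exposedFace {u x n : E3} {r : ℝ} (hx : x ∈ exposedFace u)
    (h : ∀ i m, spiralPoint i m ∈ exposedFace u → r < inner ℝ n (spiralPoint i m)) :
    r < inner ℝ n x := by
  have hc : Convex ℝ {y : E3 | r < inner ℝ n y} :=
    convex_halfSpace_gt (innerₛₗ ℝ n).isLinear _
  refine convexHull_min ?_ hc (mem_convexHull_of_mem_exposedFace hx)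
  rintro _ ⟨i, m, rfl, hv⟩
  exact h i m hv

/-- A linear equation that holds at the vertices of an exposed face holds on the face. -/
lemma inner_eq_const_of_mem_exposedFace {u x n : E3} {r : ℝ} (hx : x ∈ exposedFace u)
    (h : ∀ i m, spiralPoint i m ∈ exposedFace u → inner ℝ n (spiralPoint i m) = r) :
    inner ℝ n x = r := by
  have hc : Convex ℝ {y : E3 | inner ℝ n y = r} :=
    convex_hyperplane (innerₛₗ ℝ n).isLinear _
  refine convexHull_min ?_ hc (mem_convexHull_of_mem_exposedFace hx)
  rintro _ ⟨i, m, rfl, hv⟩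
  exact h i m hv

lemma exists_spiralPoint_mem_exposedFace {u x : E3} (hx : x ∈ exposedFace u) :
    ∃ i m, spiralPoint i m ∈ exposedFace u := by
  obtain ⟨_, i, m, -, h⟩ := convexHull_nonempty_iff.1 ⟨x, mem_convexHull_of_mem_exposedFace hx⟩
  exact ⟨i, m, h⟩

/-- Below the top the radius is positive, so a touched copy maximises the horizontal part of the
functional over the pentagon. The maximum does not depend on the level, which allows touched levels
to be compared within one copy. -/
lemma pentVal_le_of_mem_exposedFace {u : E3} {i m : Fin 5} (hi : i ≠ 0)
    (h : spiralPoint i m ∈ exposedFace u) (n : Fin 5) :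
    pentVal (u 0) (u 1) n ≤ pentVal (u 0) (u 1) m := by
  have h1 := h.2 _ (spiralPoint_mem i n)
  rw [inner_spiralPoint, inner_spiralPoint] at h1
  have h2 : 0 < levelX i / cos (π / 5) := div_pos (levelX_pos hi) cos_pi_div_five_pos
  exact le_of_mul_le_mul_left (by linarith) h2

lemma exposedFace_smul {u : E3} {t : ℝ} (ht : 0 < t) : exposedFace (t • u) = exposedFace u := by
  ext x
  simp only [exposedFace, Set.mem_ofPred_eq, inner_smul_left, RCLike.conj_to_real]
  refine and_congr_right fun _ => forall₂_congr fun y _ => ?_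
  exact mul_le_mul_iff_right₀ ht

/-- The vertices are pairwise distinct, apart from the five labels of the top vertex, and each of
them is the only maximum of some linear functional. -/
lemma exists_inner_spiralPoint_lt (i m : Fin 5) :
    ∃ u : E3, ∀ j n, (j ≠ i ∨ (i ≠ 0 ∧ n ≠ m)) →
      inner ℝ u (spiralPoint j n) < inner ℝ u (spiralPoint i m) := by
  by_cases hi : i = 0
  · refine ⟨!₂[0, 0, 1], fun j n h => ?_⟩
    have hj : j ≠ i := h.resolve_right fun h' => h'.1 hi
    simp only [inner_eq, spiralPoint_apply_two]
    simp only [Matrix.cons_val, zero_mul, one_mul, zero_add]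
    exact levelZ_strictAnti (hi ▸ (Fin.pos_iff_ne_zero.2 (hi ▸ hj)))
  · have hc := cos_pi_div_five_pos
    -- The factor κ cancels the circumradius, so copy `m` sees exactly the profile functional of
    -- slope `supportSlope i`, while the other copies see less horizontally.
    refine ⟨!₂[cos (π / 5) * pentC m, cos (π / 5) * pentS m, supportSlope i], fun j n h => ?_⟩
    have hval : ∀ j n, inner ℝ (!₂[cos (π / 5) * pentC m, cos (π / 5) * pentS m,
        supportSlope i] : E3) (spiralPoint j n) =
        levelX j * pentC (n - m) + supportSlope i * levelZ j := by
      intro j n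
      rw [inner_spiralPoint, ← pent_sub, pentVal]
      simp only [Matrix.cons_val]
      field_simp
    rw [hval, hval, sub_self, pentC_zero, mul_one]
    have hle : ∀ j, levelX j * pentC (n - m) ≤ levelX j := by
      intro j
      have h1 : pentC (n - m) ≤ 1 := cos_le_one _
      have h2 : 0 ≤ levelX j := by
        by_cases hj : j = 0
        · rw [hj, levelX_zero]
        · exact (levelX_pos hj).le
      exact mul_le_of_le_one_right h2 h1
    by_cases hj : j = i
    · subst hj
      have hn : n ≠ m := (h.resolve_left fun h' => h' rfl).2
      have h1 := pentC_lt_one (sub_ne_zero.2 hn)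
      have h2 := mul_lt_mul_of_pos_left h1 (levelX_pos hi)
      linarith
    · have := level_support_lt hi hj
      linarith [hle j]

lemma isExtreme_spiralPoint (i m : Fin 5) : spiralPoint i m ∈ vertices spiral := by
  apply exposedPoints_subset_extremePoints
  refine ⟨spiralPoint_mem i m, ?_⟩
  obtain ⟨u, hu⟩ := exists_inner_spiralPoint_lt i m
  have heq : ∀ j n, ¬ (j ≠ i ∨ (i ≠ 0 ∧ n ≠ m)) → spiralPoint j n = spiralPoint i m := by
    intro j n h
    push Not at h
    obtain ⟨rfl, h⟩ := h
    by_cases hj : j = 0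
    · rw [hj, spiralPoint_zero n, spiralPoint_zero m]
    · rw [h hj]
  have hmem : spiralPoint i m ∈ exposedFace u := by
    refine mem_exposedFace_iff.2 ⟨spiralPoint_mem i m, fun j n => ?_⟩
    by_cases h : j ≠ i ∨ (i ≠ 0 ∧ n ≠ m)
    · exact (hu j n h).le
    · rw [heq j n h]
  refine ⟨innerSL ℝ u, fun y hy => ⟨hmem.2 y hy, fun hle => ?_⟩⟩
  have hy' : y ∈ exposedFace u := ⟨hy, fun z hz => (hmem.2 z hz).trans hle⟩
  have hsub : {v | ∃ j n, v = spiralPoint j n ∧ spiralPoint j n ∈ exposedFace u} ⊆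
      {spiralPoint i m} := by
    rintro _ ⟨j, n, rfl, hv⟩
    refine heq j n fun h => ?_
    exact (hu j n h).ne (inner_eq_of_mem_exposedFace hv hmem)
  have := convexHull_mono hsub (mem_convexHull_of_mem_exposedFace hy')
  rwa [convexHull_singleton] at this

lemma vertices_spiral : vertices spiral = spiralPoints := by
  refine Set.Subset.antisymm extremePoints_convexHull_subset ?_
  rintro _ ⟨i, m, rfl⟩
  exact isExtreme_spiralPoint i m

/-- One label for each vertex. -/
def labels : Finset (Fin 5 × Fin 5) := Finset.univ.filter fun p => p.1 = 0 → p.2 = 0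

lemma injOn_labels : Set.InjOn (fun p : Fin 5 × Fin 5 => spiralPoint p.1 p.2) labels := by
  rintro ⟨i, m⟩ hp ⟨j, n⟩ hq h
  simp only [labels, Finset.coe_filter, Finset.mem_univ, true_and, Set.mem_ofPred_eq] at hp hq h
  obtain ⟨u, hu⟩ := exists_inner_spiralPoint_lt i m
  have h1 : ¬ (j ≠ i ∨ (i ≠ 0 ∧ n ≠ m)) := fun h' => (hu j n h').ne (by rw [h])
  push Not at h1
  obtain ⟨rfl, h1⟩ := h1
  by_cases hj : j = 0
  · rw [hp hj, hq hj]
  · rw [h1 hj]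

lemma image_labels :
    (fun p : Fin 5 × Fin 5 => spiralPoint p.1 p.2) '' (labels : Set (Fin 5 × Fin 5)) =
      spiralPoints := by
  ext v
  constructor
  · rintro ⟨p, -, rfl⟩
    exact ⟨p.1, p.2, rfl⟩
  · rintro ⟨i, m, rfl⟩
    by_cases hi : i = 0
    · exact ⟨(0, 0), by simp [labels], by rw [hi, spiralPoint_zero m]⟩
    · exact ⟨(i, m), by simp [labels, hi], rfl⟩

lemma numVertices_spiral : numVertices spiral = 21 := by
  rw [numVertices, vertices_spiral, ← image_labels, injOn_labels.ncard_image,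
    Set.ncard_coe_finset]
  rfl

lemma sum_labels {M : Type*} [AddCommMonoid M] (f : Fin 5 × Fin 5 → M) :
    ∑ p ∈ labels, f p = f (0, 0) + ∑ i : Fin 4, ∑ m, f (i.succ, m) := by
  rw [labels, Finset.sum_filter, Fintype.sum_prod_type, Fin.sum_univ_succ]
  congr 1
  simp

/-! ### Centre of mass and full dimension -/

/-- The centre of mass of the spiral. -/
noncomputable def center : E3 := !₂[0, 0, centerZ]

@[simp] lemma center_apply_zero : center 0 = 0 := rfl
@[simp] lemma center_apply_one : center 1 = 0 := rfl
@[simp] lemma center_apply_two : center 2 = centerZ := rfl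

lemma sum_spiralPoint (i : Fin 5) : ∑ m, spiralPoint i m = !₂[0, 0, 5 * levelZ i] := by
  apply E3_ext
  · rw [WithLp.ofLp_sum, Finset.sum_apply]
    simp only [spiralPoint_apply_zero, ← Finset.mul_sum, sum_pentC]
    simp
  · rw [WithLp.ofLp_sum, Finset.sum_apply]
    simp only [spiralPoint_apply_one, ← Finset.mul_sum, sum_pentS]
    simp
  · rw [WithLp.ofLp_sum, Finset.sum_apply]
    simp

lemma sum_labels_spiralPoint : ∑ p ∈ labels, spiralPoint p.1 p.2 = (21 : ℝ) • center := by
  rw [sum_labels]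
  simp only [sum_spiralPoint]
  rw [Fin.sum_univ_four]
  apply E3_ext
  · simp [levelX_zero]
  · simp [levelX_zero]
  · simp only [PiLp.add_apply, PiLp.smul_apply, spiralPoint_apply_two, center_apply_two, centerZ,
      smul_eq_mul, Matrix.cons_val]
    simp only [show Fin.succ (0 : Fin 4) = 1 from rfl, show Fin.succ (1 : Fin 4) = 2 from rfl,
      show Fin.succ (2 : Fin 4) = 3 from rfl, show Fin.succ (3 : Fin 4) = 4 from rfl]
    ring

lemma centerOfMass_spiral : centerOfMass spiral = center := by
  rw [centerOfMass, numVertices_spiral, vertices_spiral, ← image_labels,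
    finsum_mem_image injOn_labels, finsum_mem_coe_finset, sum_labels_spiralPoint, smul_smul]
  norm_num

lemma pent_eq_zero {a b r : ℝ} (h : ∀ m, pentVal a b m = r) : a = 0 ∧ b = 0 := by
  have h1 := sum_pentVal a b
  simp only [h] at h1
  have hr : r = 0 := by simpa using h1
  have h0 := h 0
  have h2 := h 1
  rw [hr] at h0 h2
  have ha : a = 0 := by simpa [pentVal] using h0
  refine ⟨ha, ?_⟩
  rw [pentVal, ha, pentS_one, zero_mul, zero_add] at h2
  have := sin_pi_div_five_pos
  have := cos_pi_div_five_pos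
  exact (mul_eq_zero.1 h2).resolve_right (by positivity)

/-- The pentagon of level 1 kills the horizontal part, and the height difference between level 1 and
the top kills the vertical part. -/
lemma eq_zero_of_inner_spiralPoint_const {u : E3} {r : ℝ}
    (h : ∀ i m, inner ℝ u (spiralPoint i m) = r) : u = 0 := by
  simp only [inner_spiralPoint] at h
  have hX : 0 < levelX 1 / cos (π / 5) :=
    div_pos (levelX_pos (by decide)) cos_pi_div_five_pos
  have h1 : ∀ m, pentVal (u 0) (u 1) m = (r - levelZ 1 * u 2) / (levelX 1 / cos (π / 5)) := by
    intro m
    rw [eq_div_iff hX.ne']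
    linarith [h 1 m]
  obtain ⟨ha, hb⟩ := pent_eq_zero h1
  refine E3_ext ha hb ?_
  have h2 := h 0 0
  have h3 := h 1 0
  simp only [ha, hb, pentVal, zero_mul, add_zero, mul_zero, zero_add] at h2 h3
  have h4 : (levelZ 0 - levelZ 1) * u 2 = 0 := by linarith
  have h5 : levelZ 1 < levelZ 0 := levelZ_strictAnti (by decide)
  exact (mul_eq_zero.1 h4).resolve_left (by linarith)

lemma vectorSpan_spiralPoints : vectorSpan ℝ spiralPoints = ⊤ := by
  rw [← Submodule.orthogonal_eq_bot_iff, Submodule.eq_bot_iff]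
  intro u hu
  apply eq_zero_of_inner_spiralPoint_const (r := inner ℝ u (spiralPoint 0 0))
  intro i m
  have h := (Submodule.mem_orthogonal' _ _).1 hu _
    (vsub_mem_vectorSpan ℝ (⟨i, m, rfl⟩ : spiralPoint i m ∈ spiralPoints)
      (⟨0, 0, rfl⟩ : spiralPoint 0 0 ∈ spiralPoints))
  rw [vsub_eq_sub, inner_sub_right] at h
  linarith

lemma spiralPoints_nonempty : spiralPoints.Nonempty := ⟨_, 0, 0, rfl⟩

lemma interior_spiral_nonempty : (interior spiral).Nonempty := by
  rw [spiral, interior_convexHull_nonempty_iff_affineSpan_eq_top,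
    AffineSubspace.affineSpan_eq_top_iff_vectorSpan_eq_top_of_nonempty _ _ _ spiralPoints_nonempty]
  exact vectorSpan_spiralPoints

lemma isConvexPolyhedron_spiral : IsConvexPolyhedron spiral :=
  ⟨⟨_, spiralPoints_finite, rfl⟩, interior_spiral_nonempty⟩

/-- Otherwise a functional `f` separates: `f ≤ f center` at all vertices. Its mean over the vertices
is `f center`, so equality holds at each vertex, and full dimension forces `f = 0`, against strict
separation. -/
lemma center_mem_interior : center ∈ interior spiral := by
  by_contra hc
  have hconv : Convex ℝ spiral := convex_convexHull ℝ _
  obtain ⟨f, hf⟩ := geometric_hahn_banach_open_point hconv.interior isOpen_interior hc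
  have hle : ∀ y ∈ spiral, f y ≤ f center := by
    have h1 : closure (interior spiral) ⊆ {y | f y ≤ f center} :=
      closure_minimal (fun a ha => (hf a ha).le) (isClosed_le f.continuous continuous_const)
    rw [hconv.closure_interior_eq_closure_of_nonempty_interior interior_spiral_nonempty] at h1
    exact fun y hy => h1 (subset_closure hy)
  have hsum : ∑ p ∈ labels, f (spiralPoint p.1 p.2) = ∑ p ∈ labels, f center := by
    rw [← map_sum, sum_labels_spiralPoint, map_smul, Finset.sum_const,
      show labels.card = 21 from rfl]
    simp
  have heq := (Finset.sum_eq_sum_iff_of_le fun p _ => hle _ (spiralPoint_mem p.1 p.2)).1 hsum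
  have hall : ∀ v ∈ spiralPoints, f v = f center := by
    rw [← image_labels]
    rintro _ ⟨p, hp, rfl⟩
    exact heq p hp
  have hu : (InnerProductSpace.toDual ℝ E3).symm f = 0 := by
    apply eq_zero_of_inner_spiralPoint_const (r := f center)
    intro i m
    rw [InnerProductSpace.toDual_symm_apply]
    exact hall _ ⟨i, m, rfl⟩
  have hf0 : f = 0 := by simpa using hu
  obtain ⟨a, ha⟩ := interior_spiral_nonempty
  have := hf a ha
  simp [hf0] at this

/-! ### The equilibria -/

/-- The centre of the bottom face. -/
noncomputable def bottom : E3 := !₂[0, 0, levelZ 4]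

@[simp] lemma bottom_apply_zero : bottom 0 = 0 := rfl
@[simp] lemma bottom_apply_one : bottom 1 = 0 := rfl
@[simp] lemma bottom_apply_two : bottom 2 = levelZ 4 := rfl

lemma abs_pentVal_le (a b : ℝ) (m : Fin 5) : |pentVal a b m| ≤ |a| + |b| := by
  rw [pentVal]
  refine (abs_add_le _ _).trans (add_le_add ?_ ?_) <;> rw [abs_mul]
  · exact mul_le_of_le_one_right (abs_nonneg _) (abs_cos_le_one _)
  · exact mul_le_of_le_one_right (abs_nonneg _) (abs_sin_le_one _)

/-- The bottom face contains a neighbourhood of its centre in its plane. -/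
lemma mem_spiral_of_near_bottom {v : E3} (h2 : v 2 = levelZ 4)
    (h : |v 0| + |v 1| ≤ levelX 4 / 2) : v ∈ spiral := by
  have hc := cos_pi_div_five_pos
  have hX : 0 < levelX 4 := levelX_pos (by decide)
  -- Barycentric weights: the uniform part gives the centre, and the linear part reproduces `v 0`,
  -- `v 1` since the second moments of the pentagon are 5/2 times the identity. The assumed bound on
  -- `v` keeps the linear part at least -κ/5.
  set w : Fin 5 → ℝ := fun m =>
    1 / 5 + 2 / 5 * (cos (π / 5) / levelX 4) * pentVal (v 0) (v 1) m with hw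
  have hw0 : ∀ m, 0 ≤ w m := by
    intro m
    have h1 := (abs_le.1 ((abs_pentVal_le (v 0) (v 1) m).trans h)).1
    have h3 : cos (π / 5) / levelX 4 * (-(levelX 4 / 2)) ≤
        cos (π / 5) / levelX 4 * pentVal (v 0) (v 1) m := by gcongr
    have h4 : cos (π / 5) / levelX 4 * (-(levelX 4 / 2)) = -(cos (π / 5) / 2) := by
      field_simp
    have h5 := cos_le_one (π / 5)
    simp only [hw]
    linarith
  have hw1 : ∑ m, w m = 1 := by
    simp only [hw, Finset.sum_add_distrib, ← Finset.mul_sum, sum_pentVal]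
    simp
  have hv : v = ∑ m, w m • spiralPoint 4 m := by
    have e1 : ∑ m, pentVal (v 0) (v 1) m * pentC m = 5 / 2 * v 0 := by
      simp only [pentVal, add_mul, mul_assoc, Finset.sum_add_distrib, ← Finset.mul_sum,
        mul_comm (pentS _) (pentC _), sum_pentC_sq, sum_pentC_mul_pentS]
      ring
    have e2 : ∑ m, pentVal (v 0) (v 1) m * pentS m = 5 / 2 * v 1 := by
      simp only [pentVal, add_mul, mul_assoc, Finset.sum_add_distrib, ← Finset.mul_sum,
        sum_pentS_sq, sum_pentC_mul_pentS]
      ring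
    apply E3_ext
    · rw [WithLp.ofLp_sum, Finset.sum_apply]
      have : ∀ m, (w m • spiralPoint 4 m) 0 = levelX 4 / cos (π / 5) / 5 * pentC m +
          2 / 5 * (pentVal (v 0) (v 1) m * pentC m) := by
        intro m
        simp only [PiLp.smul_apply, spiralPoint_apply_zero, smul_eq_mul, hw]
        field_simp
      simp only [this, Finset.sum_add_distrib, ← Finset.mul_sum, sum_pentC, e1]
      ring
    · rw [WithLp.ofLp_sum, Finset.sum_apply]
      have : ∀ m, (w m • spiralPoint 4 m) 1 = levelX 4 / cos (π / 5) / 5 * pentS m +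
          2 / 5 * (pentVal (v 0) (v 1) m * pentS m) := by
        intro m
        simp only [PiLp.smul_apply, spiralPoint_apply_one, smul_eq_mul, hw]
        field_simp
      simp only [this, Finset.sum_add_distrib, ← Finset.mul_sum, sum_pentS, e2]
      ring
    · rw [WithLp.ofLp_sum, Finset.sum_apply]
      simp only [PiLp.smul_apply, spiralPoint_apply_two, smul_eq_mul, ← Finset.sum_mul, hw1, h2,
        one_mul]
  rw [hv]
  exact (convex_convexHull ℝ _).sum_mem (fun m _ => hw0 m) hw1
    (fun m _ => spiralPoint_mem 4 m)

lemma bottom_mem : bottom ∈ spiral :=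
  mem_spiral_of_near_bottom rfl (by
    have : 0 < levelX 4 := levelX_pos (by decide)
    simpa using (half_pos this).le)

lemma levelZ_four_le (i : Fin 5) : levelZ 4 ≤ levelZ i := levelZ_strictAnti.antitone (Fin.le_last i)

lemma levelZ_le_zero (i : Fin 5) : levelZ i ≤ levelZ 0 := levelZ_strictAnti.antitone (Fin.zero_le i)

lemma inner_vertical {u : E3} (h0 : u 0 = 0) (h1 : u 1 = 0) (v : E3) :
    inner ℝ u v = u 2 * v 2 := by
  rw [inner_eq, h0, h1]; ring

lemma exposedFace_up {u : E3} (h0 : u 0 = 0) (h1 : u 1 = 0) (h2 : 0 < u 2) :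
    exposedFace u = {spiralPoint 0 0} := by
  have hmem : spiralPoint 0 0 ∈ exposedFace u := by
    refine mem_exposedFace_iff.2 ⟨spiralPoint_mem 0 0, fun i m => ?_⟩
    rw [inner_vertical h0 h1, inner_vertical h0 h1]
    exact mul_le_mul_of_nonneg_left (levelZ_le_zero i) h2.le
  refine Set.Subset.antisymm (fun x hx => ?_) (by simpa using hmem)
  have hsub : {v | ∃ j n, v = spiralPoint j n ∧ spiralPoint j n ∈ exposedFace u} ⊆
      {spiralPoint 0 0} := by
    rintro _ ⟨j, n, rfl, hv⟩
    have h3 := inner_eq_of_mem_exposedFace hv hmem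
    rw [inner_vertical h0 h1, inner_vertical h0 h1] at h3
    have h4 : j = 0 := levelZ_strictAnti.injective (mul_left_cancel₀ h2.ne' h3)
    rw [h4, spiralPoint_zero n]
    rfl
  have := convexHull_mono hsub (mem_convexHull_of_mem_exposedFace hx)
  rwa [convexHull_singleton] at this

lemma mem_exposedFace_down {u x : E3} (h0 : u 0 = 0) (h1 : u 1 = 0) (h2 : u 2 < 0) :
    x ∈ exposedFace u ↔ x ∈ spiral ∧ x 2 = levelZ 4 := by
  have hbot : bottom ∈ exposedFace u := by
    refine mem_exposedFace_iff.2 ⟨bottom_mem, fun i m => ?_⟩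
    rw [inner_vertical h0 h1, inner_vertical h0 h1]
    exact mul_le_mul_of_nonpos_left (levelZ_four_le i) h2.le
  constructor
  · intro hx
    refine ⟨hx.1, ?_⟩
    have h3 := inner_eq_of_mem_exposedFace hx hbot
    rw [inner_vertical h0 h1, inner_vertical h0 h1] at h3
    exact mul_left_cancel₀ h2.ne h3
  · rintro ⟨hx, hx2⟩
    refine mem_exposedFace_iff.2 ⟨hx, fun i m => ?_⟩
    rw [inner_vertical h0 h1, inner_vertical h0 h1, hx2]
    exact mul_le_mul_of_nonpos_left (levelZ_four_le i) h2.le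

/-- An equilibrium lies on the face that is exposed in its own direction from the centre. -/
lemma mem_exposedFace_of_isEquilibrium {q : E3} (h : IsEquilibrium spiral center q) :
    q ∈ exposedFace (q - center) := by
  refine ⟨?_, fun y hy => ?_⟩
  · rw [← isClosed_spiral.closure_eq]
    exact frontier_subset_closure h.1
  · have := h.2 y hy
    rw [real_inner_comm, inner_sub_right] at this
    linarith

lemma contactSet_eq_exposedFace {q : E3} (h : q ∈ exposedFace (q - center)) :
    contactSet spiral center q = exposedFace (q - center) := by
  ext x
  simp only [contactSet, Set.mem_ofPred_eq]
  rw [real_inner_comm, inner_sub_right, sub_eq_zero]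
  exact ⟨fun hx => ⟨hx.1, fun y hy => hx.2 ▸ h.2 y hy⟩,
    fun hx => ⟨hx.1, inner_eq_of_mem_exposedFace hx h⟩⟩

lemma isEquilibrium_of_mem_exposedFace {q : E3} (hq : q ≠ center)
    (h : q ∈ exposedFace (q - center)) : IsEquilibrium spiral center q := by
  refine ⟨⟨subset_closure h.1, notMem_interior_of_isMax (sub_ne_zero.2 hq) h.2⟩, fun y hy => ?_⟩
  have := h.2 y hy
  rw [real_inner_comm, inner_sub_right]
  linarith

/-- No direction off the axis carries an equilibrium. -/
lemma vertical_of_mem_exposedFace {q : E3} (h : q ∈ exposedFace (q - center)) :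
    q 0 = 0 ∧ q 1 = 0 := by
  by_contra hab
  set u : E3 := q - center with hu
  have hu0 : u 0 = q 0 := by simp [hu]
  have hu1 : u 1 = q 1 := by simp [hu]
  have hu2 : u 2 = q 2 - centerZ := by simp [hu]
  have hκ := cos_pi_div_five_pos
  obtain ⟨j₀, n₀, hj₀⟩ := exists_spiralPoint_mem_exposedFace h
  -- The largest index is the lowest touched level; the ascent inequalities are available only for
  -- levels at or above it.
  obtain ⟨i, ⟨m, him⟩, hmax⟩ := Set.exists_max_image {i | ∃ m, spiralPoint i m ∈ exposedFace u} id
    (Set.toFinite _) ⟨j₀, n₀, hj₀⟩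
  have hmax' : ∀ j n, spiralPoint j n ∈ exposedFace u → j ≤ i := fun j n hj => hmax j ⟨n, hj⟩
  -- If only the top vertex is touched, the face is that vertex and `q` is on the axis.
  by_cases hi : i = 0
  · apply hab
    constructor
    · have := inner_eq_const_of_mem_exposedFace (n := !₂[1, 0, 0]) (r := 0) h fun j n hj => by
        have : j = 0 := Fin.le_zero_iff.1 (hi ▸ hmax' j n hj)
        rw [inner_eq, this, spiralPoint_apply_zero, levelX_zero]
        simp
      simpa [inner_eq] using this
    · have := inner_eq_const_of_mem_exposedFace (n := !₂[0, 1, 0]) (r := 0) h fun j n hj => by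
        have : j = 0 := Fin.le_zero_iff.1 (hi ▸ hmax' j n hj)
        rw [inner_eq, this, spiralPoint_apply_one, levelX_zero]
        simp
      simpa [inner_eq] using this
  obtain ⟨l, rfl⟩ : ∃ l : Fin 4, i = l.succ := ⟨i.pred hi, by simp⟩
  have hpmax := pentVal_le_of_mem_exposedFace hi him
  have hab' : ¬ (u 0 = 0 ∧ u 1 = 0) := by rwa [hu0, hu1]
  have hp := pentVal_pos_of_max hab' hpmax
  have hlow := cos_sq_mul_le_of_max hpmax
  have hupp := pentVal_sq_le (u 0) (u 1) m
  -- Support tested at the vertex directly above: the step up does not gain in direction `u`.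
  have hup := h.2 _ (spiralPoint_mem l.castSucc m)
  rw [← inner_eq_of_mem_exposedFace him h, inner_spiralPoint, inner_spiralPoint] at hup
  have hval : ∀ j n, spiralPoint j n ∈ exposedFace u →
      levelX j * pentVal (u 0) (u 1) n = levelX j * pentVal (u 0) (u 1) m := by
    intro j n hj
    by_cases hj0 : j = 0
    · rw [hj0, levelX_zero]; ring
    · rw [le_antisymm (hpmax n) (pentVal_le_of_mem_exposedFace hj0 hj m)]
  set p := pentVal (u 0) (u 1) m with hpdef
  -- a linear functional that attains `A X_j + B Z_j` at the vertices of the face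
  have hlin : ∀ A B r : ℝ, (∀ j ≤ l.succ, r < A * levelX j + B * levelZ j) →
      r < A * ((u 0 ^ 2 + u 1 ^ 2) * cos (π / 5) / p) + B * q 2 := by
    intro A B r hr
    have := inner_lt_of_mem_exposedFace (r := r)
      (n := !₂[A * cos (π / 5) / p * u 0, A * cos (π / 5) / p * u 1, B]) h fun j n hj => by
        refine (hr j (hmax' j n hj)).trans_eq ?_
        have h1 := hval j n hj
        rw [inner_spiralPoint]
        simp only [Matrix.cons_val]
        have h2 : pentVal (A * cos (π / 5) / p * u 0) (A * cos (π / 5) / p * u 1) n =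
            A * cos (π / 5) / p * pentVal (u 0) (u 1) n := by
          rw [pentVal, pentVal]; ring
        rw [h2]
        have h3 : levelX j / cos (π / 5) * (A * cos (π / 5) / p * pentVal (u 0) (u 1) n) =
            A / p * (levelX j * pentVal (u 0) (u 1) n) := by
          field_simp
        rw [h3, h1]
        field_simp
    rw [inner_eq] at this
    simp only [Matrix.cons_val, ← hu0, ← hu1] at this
    refine this.trans_eq ?_
    field_simp
  by_cases hl : l = 0
  · subst hl
    change levelX 0 / cos (π / 5) * p + levelZ 0 * u 2 ≤
      levelX 1 / cos (π / 5) * p + levelZ 1 * u 2 at hup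
    have h1 := hlin (levelX 0 - levelX 1) ((levelZ 0 - levelZ 1) * cos (π / 5) ^ 2)
      ((levelZ 0 - levelZ 1) * cos (π / 5) ^ 2 * centerZ) fun j hj => by
        have := level_ascent_top (j := j) hj
        linarith
    -- On the top edge the horizontal change is negative, so the needed estimate is p² ≤ `u 0 ^ 2 +
    -- u 1 ^ 2`.
    have hX : levelX 0 - levelX 1 ≤ 0 := by
      rw [levelX_zero]
      linarith [levelX_pos (i := 1) (by decide)]
    have h2 : p * cos (π / 5) ≤ (u 0 ^ 2 + u 1 ^ 2) * cos (π / 5) / p := by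
      rw [le_div_iff₀ hp]
      nlinarith
    have h3 := mul_le_mul_of_nonpos_left h2 hX
    have h4 : ((levelX 0 - levelX 1) * p / cos (π / 5) + (levelZ 0 - levelZ 1) * u 2) *
        cos (π / 5) ^ 2 ≤ 0 := by
      apply mul_nonpos_of_nonpos_of_nonneg _ (by positivity)
      have : (levelX 0 - levelX 1) * p / cos (π / 5) =
        levelX 0 / cos (π / 5) * p - levelX 1 / cos (π / 5) * p := by ring
      linarith
    have h5 : ((levelX 0 - levelX 1) * p / cos (π / 5) + (levelZ 0 - levelZ 1) * u 2) *
        cos (π / 5) ^ 2 = (levelX 0 - levelX 1) * (p * cos (π / 5)) +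
          (levelZ 0 - levelZ 1) * cos (π / 5) ^ 2 * (q 2 - centerZ) := by
      rw [hu2]
      field_simp
    linarith
  · have h1 := hlin (levelX l.castSucc - levelX l.succ) (levelZ l.castSucc - levelZ l.succ)
      ((levelZ l.castSucc - levelZ l.succ) * centerZ) fun j hj => by
        have := (level_ascent hl hj).2
        linarith
    -- On the lower steps the horizontal change is nonnegative, and the inradius bound `hlow` is the
    -- one needed.
    have hX := (level_ascent hl (j := 0) (Fin.zero_le _)).1
    have h2 : (u 0 ^ 2 + u 1 ^ 2) * cos (π / 5) / p ≤ p / cos (π / 5) := by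
      rw [div_le_div_iff₀ hp hκ]
      nlinarith
    have h3 := mul_le_mul_of_nonneg_left h2 (sub_nonneg.2 hX)
    have h4 : (levelX l.castSucc - levelX l.succ) * (p / cos (π / 5)) =
      levelX l.castSucc / cos (π / 5) * p - levelX l.succ / cos (π / 5) * p := by ring
    rw [hu2] at hup
    linarith

lemma eq_top_or_bottom {q : E3} (h : IsEquilibrium spiral center q) :
    q = spiralPoint 0 0 ∨ q = bottom := by
  have hq := mem_exposedFace_of_isEquilibrium h
  obtain ⟨h0, h1⟩ := vertical_of_mem_exposedFace hq
  have hu0 : (q - center) 0 = 0 := by simp [h0]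
  have hu1 : (q - center) 1 = 0 := by simp [h1]
  rcases lt_trichotomy ((q - center) 2) 0 with hneg | hz | hpos
  · right
    exact E3_ext h0 h1 ((mem_exposedFace_down hu0 hu1 hneg).1 hq).2
  · exfalso
    have : q = center := sub_eq_zero.1 (E3_ext hu0 hu1 hz)
    -- The centre itself satisfies the support inequality trivially and is excluded only because it
    -- is not on the boundary.
    exact h.1.2 (this ▸ center_mem_interior)
  · left
    rw [exposedFace_up hu0 hu1 hpos] at hq
    exact hq

lemma exposedFace_top_sub_center :
    exposedFace (spiralPoint 0 0 - center) = {spiralPoint 0 0} := by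
  apply exposedFace_up
  · simp [levelX_zero]
  · simp [levelX_zero]
  · simpa using centerZ_lt_levelZ_zero

lemma mem_exposedFace_bottom_sub_center {x : E3} :
    x ∈ exposedFace (bottom - center) ↔ x ∈ spiral ∧ x 2 = levelZ 4 := by
  apply mem_exposedFace_down
  · simp
  · simp
  · simpa using levelZ_four_lt_centerZ

lemma isEquilibrium_top : IsEquilibrium spiral center (spiralPoint 0 0) := by
  apply isEquilibrium_of_mem_exposedFace
  · intro h
    have := congrArg (fun v : E3 => v 2) h
    exact centerZ_lt_levelZ_zero.ne' this
  · rw [exposedFace_top_sub_center]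
    rfl

lemma isEquilibrium_bottom : IsEquilibrium spiral center bottom := by
  apply isEquilibrium_of_mem_exposedFace
  · intro h
    have := congrArg (fun v : E3 => v 2) h
    exact levelZ_four_lt_centerZ.ne this
  · rw [mem_exposedFace_bottom_sub_center]
    exact ⟨bottom_mem, rfl⟩

lemma contactSet_top : contactSet spiral center (spiralPoint 0 0) = {spiralPoint 0 0} := by
  rw [contactSet_eq_exposedFace (mem_exposedFace_of_isEquilibrium isEquilibrium_top),
    exposedFace_top_sub_center]

lemma contactSet_bottom :
    contactSet spiral center bottom = exposedFace (bottom - center) :=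
  contactSet_eq_exposedFace (mem_exposedFace_of_isEquilibrium isEquilibrium_bottom)

lemma isNondegenerateEquilibrium_top :
    IsNondegenerateEquilibrium spiral center (spiralPoint 0 0) := by
  refine ⟨isEquilibrium_top, ?_⟩
  rw [contactSet_top, intrinsicInterior_singleton]
  rfl

lemma isNondegenerateEquilibrium_bottom :
    IsNondegenerateEquilibrium spiral center bottom := by
  refine ⟨isEquilibrium_bottom, ?_⟩
  rw [contactSet_bottom, mem_intrinsicInterior]
  set S := exposedFace (bottom - center) with hS
  have hbS : bottom ∈ S := mem_exposedFace_bottom_sub_center.2 ⟨bottom_mem, rfl⟩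
  refine ⟨⟨bottom, subset_affineSpan ℝ S hbS⟩, ?_, rfl⟩
  -- The affine span stays in the bottom plane, where all points near the axis belong to the
  -- polyhedron.
  have hplane : ∀ y ∈ affineSpan ℝ S, y 2 = levelZ 4 := by
    intro y hy
    refine affineSpan_induction (p := fun y : E3 => y 2 = levelZ 4) hy
      (fun x hx => (mem_exposedFace_bottom_sub_center.1 hx).2) fun c a b d ha hb hd => ?_
    simp [ha, hb, hd]
  have hX : 0 < levelX 4 := levelX_pos (by decide)
  rw [mem_interior_iff_mem_nhds]
  have hcont : Continuous fun y : affineSpan ℝ S => |(y : E3) 0| + |(y : E3) 1| := by fun_prop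
  have hopen : IsOpen {y : affineSpan ℝ S | |(y : E3) 0| + |(y : E3) 1| < levelX 4 / 2} :=
    isOpen_lt hcont continuous_const
  refine Filter.mem_of_superset (hopen.mem_nhds ?_) ?_
  · simpa using hX
  · intro y hy
    exact mem_exposedFace_bottom_sub_center.2
      ⟨mem_spiral_of_near_bottom (hplane y y.2) (le_of_lt hy), hplane y y.2⟩

/-! ### The 21 faces -/

lemma spiralPoint_ne {i m n : Fin 5} (hi : i ≠ 0) (hmn : m ≠ n) :
    spiralPoint i m ≠ spiralPoint i n := by
  obtain ⟨u, hu⟩ := exists_inner_spiralPoint_lt i n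
  intro h
  exact (hu i m (Or.inr ⟨hi, hmn⟩)).ne (by rw [h])

lemma finrank_E3 : Module.finrank ℝ E3 = 3 := by simp

lemma finrank_exposedFace_le_two {u : E3} (hu : u ≠ 0) :
    Module.finrank ℝ (vectorSpan ℝ (exposedFace u)) ≤ 2 := by
  have h := finrank_vectorSpan_add_le (s := exposedFace u) (n := ![u])
    (LinearIndependent.of_subsingleton 0 (by simpa using hu)) fun i x hx y hy => by
      simpa using inner_eq_of_mem_exposedFace hx hy
  rw [finrank_E3] at h
  omega

lemma finrank_exposedFace_le_one {u n : E3} {r : ℝ} (h : LinearIndependent ℝ ![u, n])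
    (hn : ∀ i m, spiralPoint i m ∈ exposedFace u → inner ℝ n (spiralPoint i m) = r) :
    Module.finrank ℝ (vectorSpan ℝ (exposedFace u)) ≤ 1 := by
  have h := finrank_vectorSpan_add_le (s := exposedFace u) h fun i x hx y hy => by
    fin_cases i
    · exact inner_eq_of_mem_exposedFace hx hy
    · exact (inner_eq_const_of_mem_exposedFace hx hn).trans
        (inner_eq_const_of_mem_exposedFace hy hn).symm
  rw [finrank_E3] at h
  omega

/-- Outward normals of the 21 faces: the bottom pentagon, and the side faces between the levels `l`
and `l + 1`, adjacent to the copies `k` and `k + 1`. -/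
noncomputable def faceNormal : Option (Fin 4 × Fin 5) → E3
  | none => !₂[0, 0, -1]
  | some (l, k) => !₂[(levelZ l.castSucc - levelZ l.succ) * sideC k,
      (levelZ l.castSucc - levelZ l.succ) * sideS k,
      2 * cos (π / 5) * (levelX l.succ - levelX l.castSucc)]

lemma levelZ_sub_pos (l : Fin 4) : 0 < levelZ l.castSucc - levelZ l.succ :=
  sub_pos.2 (levelZ_strictAnti Fin.castSucc_lt_succ)

lemma levelX_nonneg (i : Fin 5) : 0 ≤ levelX i := by
  by_cases hi : i = 0
  · rw [hi, levelX_zero]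
  · exact (levelX_pos hi).le

/-- Since κ + 1/2 = 2κ², an endpoint of side `k` on the level of apothem X contributes 2κX times the
height difference; hence the factor 2κ in the vertical coordinate of the normal. The value is thus
2κ times the profile functional minus a nonnegative defect, which below the top vanishes only at the
endpoints of side `k`. -/
lemma inner_faceNormal (l : Fin 4) (k j n : Fin 5) :
    inner ℝ (faceNormal (some (l, k))) (spiralPoint j n) =
      2 * cos (π / 5) * ((levelZ l.castSucc - levelZ l.succ) * levelX j
        + (levelX l.succ - levelX l.castSucc) * levelZ j)
      - levelX j / cos (π / 5) * (levelZ l.castSucc - levelZ l.succ) *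
        (cos (π / 5) + 1 / 2 - pentVal (sideC k) (sideS k) n) := by
  have hκ := cos_pi_div_five_pos
  have hk := four_mul_cos_pi_div_five_sq
  rw [inner_spiralPoint]
  simp only [faceNormal, Matrix.cons_val, pentVal]
  field_simp
  linear_combination (-(levelX j) * (levelZ l.castSucc - levelZ l.succ)) * hk

lemma inner_faceNormal_le (l : Fin 4) (k j n : Fin 5) :
    inner ℝ (faceNormal (some (l, k))) (spiralPoint j n) ≤
      2 * cos (π / 5) * ((levelZ l.castSucc - levelZ l.succ) * levelX l.castSucc
        + (levelX l.succ - levelX l.castSucc) * levelZ l.castSucc) := by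
  have hκ := cos_pi_div_five_pos
  rw [inner_faceNormal]
  have h1 : (levelZ l.castSucc - levelZ l.succ) * levelX j
        + (levelX l.succ - levelX l.castSucc) * levelZ j ≤
      (levelZ l.castSucc - levelZ l.succ) * levelX l.castSucc
        + (levelX l.succ - levelX l.castSucc) * levelZ l.castSucc := by
    by_cases h1 : j = l.castSucc
    · rw [h1]
    by_cases h2 : j = l.succ
    · rw [h2]; linarith
    exact (level_normal_lt l j h1 h2).le
  have h2 := mul_le_mul_of_nonneg_left h1 (by positivity : 0 ≤ 2 * cos (π / 5))
  have h3 : 0 ≤ levelX j / cos (π / 5) * (levelZ l.castSucc - levelZ l.succ) *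
      (cos (π / 5) + 1 / 2 - pentVal (sideC k) (sideS k) n) :=
    mul_nonneg (mul_nonneg (div_nonneg (levelX_nonneg j) hκ.le) (levelZ_sub_pos l).le)
      (sub_nonneg.2 (pentVal_side_le k n))
  linarith

lemma spiralPoint_mem_faceNormal {l : Fin 4} {k j n : Fin 5} (hj : j = l.castSucc ∨ j = l.succ)
    (hn : n = k ∨ n = k + 1) : spiralPoint j n ∈ exposedFace (faceNormal (some (l, k))) := by
  refine mem_exposedFace_iff.2 ⟨spiralPoint_mem j n, fun i m => ?_⟩
  refine (inner_faceNormal_le l k i m).trans_eq ?_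
  have hval : pentVal (sideC k) (sideS k) n = cos (π / 5) + 1 / 2 := by
    rcases hn with rfl | rfl
    · exact pentVal_side_left _
    · exact pentVal_side_right _
  rw [inner_faceNormal, hval, sub_self, mul_zero, sub_zero]
  rcases hj with rfl | rfl
  · rfl
  · ring

/-- A touched vertex must maximise the profile functional and have zero defect. At the top the
defect carries no information, because all five labels name one point. -/
lemma of_spiralPoint_mem_faceNormal {l : Fin 4} {k j n : Fin 5}
    (h : spiralPoint j n ∈ exposedFace (faceNormal (some (l, k)))) :
    (j = l.castSucc ∨ j = l.succ) ∧ (j ≠ 0 → n = k ∨ n = k + 1) := by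
  have hκ := cos_pi_div_five_pos
  have h1 := h.2 _ (spiralPoint_mem l.castSucc k)
  rw [inner_faceNormal, inner_faceNormal, pentVal_side_left, sub_self, mul_zero, sub_zero] at h1
  have h2 : 0 ≤ levelX j / cos (π / 5) * (levelZ l.castSucc - levelZ l.succ) :=
    mul_nonneg (div_nonneg (levelX_nonneg j) hκ.le) (levelZ_sub_pos l).le
  have h3 := sub_nonneg.2 (pentVal_side_le k n)
  have hj : j = l.castSucc ∨ j = l.succ := by
    by_contra! hj
    have h4 := mul_lt_mul_of_pos_left (level_normal_lt l j hj.1 hj.2)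
      (by positivity : 0 < 2 * cos (π / 5))
    have := mul_nonneg h2 h3
    linarith
  refine ⟨hj, fun hj0 => ?_⟩
  by_contra! hn
  have h4 := mul_pos (mul_pos (div_pos (levelX_pos hj0) hκ) (levelZ_sub_pos l))
    (sub_pos.2 (pentVal_side_lt hn.1 hn.2))
  rcases hj with rfl | rfl <;> linarith

lemma mem_exposedFace_bottomNormal {x : E3} :
    x ∈ exposedFace (faceNormal none) ↔ x ∈ spiral ∧ x 2 = levelZ 4 :=
  mem_exposedFace_down rfl rfl (by simp [faceNormal])

lemma finrank_bottomFace :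
    Module.finrank ℝ (vectorSpan ℝ (exposedFace (faceNormal none))) = 2 := by
  have hκ := cos_pi_div_five_pos
  apply le_antisymm
  · apply finrank_exposedFace_le_two
    intro h
    have := congrArg (fun v : E3 => v 2) h
    simp [faceNormal] at this
  · have hm : ∀ m, spiralPoint 4 m ∈ exposedFace (faceNormal none) := fun m =>
      mem_exposedFace_bottomNormal.2 ⟨spiralPoint_mem 4 m, rfl⟩
    refine two_le_finrank_vectorSpan (hm 0) (hm 1) (hm 2) ?_
    rw [LinearIndependent.pair_iff]
    intro s t h
    have h0 := congrArg (fun v : E3 => v 0) h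
    have h1 := congrArg (fun v : E3 => v 1) h
    simp only [PiLp.add_apply, PiLp.smul_apply, PiLp.sub_apply, PiLp.zero_apply, smul_eq_mul,
      spiralPoint_apply_zero, spiralPoint_apply_one, pentC_zero, pentC_one, pentC_two,
      pentS_zero, pentS_one, pentS_two] at h0 h1
    have hX : 0 < levelX 4 / cos (π / 5) := div_pos (levelX_pos (by decide)) hκ
    have h0' : levelX 4 / cos (π / 5) *
        (s * (cos (π / 5) - 3 / 2) - t * (cos (π / 5) + 1)) = 0 := by linear_combination h0
    have h1' : levelX 4 / cos (π / 5) * sin (π / 5) * (s * (2 * cos (π / 5)) + t) = 0 := by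
      linear_combination h1
    have e0 := (mul_eq_zero.1 h0').resolve_left hX.ne'
    have e1 := (mul_eq_zero.1 h1').resolve_left (mul_pos hX sin_pi_div_five_pos).ne'
    have hs : s * (4 * cos (π / 5) - 1) = 0 := by
      linear_combination e0 + (cos (π / 5) + 1) * e1 - s / 2 * four_mul_cos_pi_div_five_sq
    have hs0 : s = 0 := by
      refine (mul_eq_zero.1 hs).resolve_right ?_
      have := abs_le.1 abs_cos_pi_div_five
      intro h
      linarith
    refine ⟨hs0, ?_⟩
    rw [hs0] at e1
    linarith

lemma finrank_faceNormal (d : Option (Fin 4 × Fin 5)) :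
    Module.finrank ℝ (vectorSpan ℝ (exposedFace (faceNormal d))) = 2 := by
  obtain _ | ⟨l, k⟩ := d
  · exact finrank_bottomFace
  have h1 : spiralPoint l.succ k ∈ exposedFace (faceNormal (some (l, k))) :=
    spiralPoint_mem_faceNormal (Or.inr rfl) (Or.inl rfl)
  have h2 : spiralPoint l.succ (k + 1) ∈ exposedFace (faceNormal (some (l, k))) :=
    spiralPoint_mem_faceNormal (Or.inr rfl) (Or.inr rfl)
  have h3 : spiralPoint l.castSucc k ∈ exposedFace (faceNormal (some (l, k))) :=
    spiralPoint_mem_faceNormal (Or.inl rfl) (Or.inl rfl)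
  apply le_antisymm
  · apply finrank_exposedFace_le_two
    intro h
    -- A zero normal would expose every vertex, including a copy that is not on side `k`.
    have h4 : spiralPoint l.succ (k + 2) ∈ exposedFace (faceNormal (some (l, k))) := by
      rw [h]
      exact mem_exposedFace_iff.2 ⟨spiralPoint_mem _ _, by simp⟩
    have h5 := (of_spiralPoint_mem_faceNormal h4).2 (Fin.succ_ne_zero l)
    clear * - h5
    revert k
    decide
  · refine two_le_finrank_vectorSpan h1 h2 h3 ?_
    rw [LinearIndependent.pair_iff]
    intro s t h
    have e2 := congrArg (fun v : E3 => v 2) h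
    simp only [PiLp.add_apply, PiLp.smul_apply, PiLp.sub_apply, PiLp.zero_apply, smul_eq_mul,
      spiralPoint_apply_two, sub_self, mul_zero, zero_add] at e2
    have ht : t = 0 := (mul_eq_zero.1 e2).resolve_right (levelZ_sub_pos l).ne'
    rw [ht, zero_smul, add_zero] at h
    refine ⟨(smul_eq_zero.1 h).resolve_right (sub_ne_zero.2 ?_), ht⟩
    apply spiralPoint_ne (Fin.succ_ne_zero l)
    clear * -
    revert k
    decide

/-- A side face determines its two levels, and its copies {k, k + 1} in ℤ/5 determine k. The copies
are read off at level `l.succ`, which is never the top. -/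
lemma injective_exposedFace_faceNormal :
    Function.Injective fun d => exposedFace (faceNormal d) := by
  have hbot : ∀ l k, exposedFace (faceNormal none) ≠ exposedFace (faceNormal (some (l, k))) := by
    intro l k h
    have h1 : spiralPoint l.castSucc k ∈ exposedFace (faceNormal none) := by
      rw [h]
      exact spiralPoint_mem_faceNormal (Or.inl rfl) (Or.inl rfl)
    have h2 := (mem_exposedFace_bottomNormal.1 h1).2
    have h3 := levelZ_strictAnti.injective h2
    exact (Fin.castSucc_lt_last l).ne h3
  rintro (_ | ⟨l, k⟩) (_ | ⟨l', k'⟩) h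
  · rfl
  · exact absurd h (hbot l' k')
  · exact absurd h.symm (hbot l k)
  · have hmem : ∀ j n, (j = l.castSucc ∨ j = l.succ) → (n = k ∨ n = k + 1) →
        (j = l'.castSucc ∨ j = l'.succ) ∧ (j ≠ 0 → n = k' ∨ n = k' + 1) := by
      intro j n hj hn
      apply of_spiralPoint_mem_faceNormal
      exact h.subset (spiralPoint_mem_faceNormal hj hn)
    have h1 := (hmem l.castSucc k (Or.inl rfl) (Or.inl rfl)).1
    have h2 := hmem l.succ k (Or.inr rfl) (Or.inl rfl)
    have h3 := (hmem l.succ (k + 1) (Or.inr rfl) (Or.inr rfl)).2 (Fin.succ_ne_zero l)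
    have h4 := h2.2 (Fin.succ_ne_zero l)
    have hl : l = l' := by
      have h2' := h2.1
      clear * - h1 h2'
      revert l l'
      decide
    have hk : k = k' := by
      clear * - h3 h4
      revert k k'
      decide
    rw [hl, hk]

/-- Every two-dimensional exposed subset of the spiral is one of the 21 faces. -/
lemma exists_faceNormal_of_finrank {u : E3}
    (hdim : Module.finrank ℝ (vectorSpan ℝ (exposedFace u)) = 2) :
    ∃ d, exposedFace u = exposedFace (faceNormal d) := by
  have hκ := cos_pi_div_five_pos
  by_cases hab : u 0 = 0 ∧ u 1 = 0
  · obtain ⟨h0, h1⟩ := hab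
    rcases lt_trichotomy (u 2) 0 with h2 | h2 | h2
    · refine ⟨none, ?_⟩
      ext x
      rw [mem_exposedFace_down h0 h1 h2, mem_exposedFace_bottomNormal]
    · exfalso
      have hu : u = 0 := E3_ext h0 h1 h2
      have : exposedFace u = spiral := by
        ext x
        simp [exposedFace, hu]
      rw [this, spiral, vectorSpan_convexHull, vectorSpan_spiralPoints, finrank_top,
        finrank_E3] at hdim
      omega
    · exfalso
      rw [exposedFace_up h0 h1 h2, vectorSpan_singleton, finrank_bot] at hdim
      omega
  -- two levels are touched
  obtain ⟨i, m, j, n, hij, hi, hj⟩ : ∃ i m j n, i < j ∧ spiralPoint i m ∈ exposedFace u ∧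
      spiralPoint j n ∈ exposedFace u := by
    by_contra! hno
    have hne : (exposedFace u).Nonempty := by
      by_contra! hemp
      rw [hemp, vectorSpan_empty, finrank_bot] at hdim
      omega
    obtain ⟨x, hx⟩ := hne
    obtain ⟨i, m, hi⟩ := exists_spiralPoint_mem_exposedFace hx
    have hlev : ∀ j n, spiralPoint j n ∈ exposedFace u → j = i := by
      intro j n hj
      rcases lt_trichotomy j i with h | h | h
      · exact absurd hi (hno j n i m h hj)
      · exact h
      · exact absurd hj (hno i m j n h hi)
    -- With one level touched, the height is constant on the face and independent of `u`, so the
    -- dimension is at most one.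
    have hind : LinearIndependent ℝ ![u, !₂[0, 0, 1]] := by
      rw [LinearIndependent.pair_iff]
      intro s t h
      have e0 := congrArg (fun v : E3 => v 0) h
      have e1 := congrArg (fun v : E3 => v 1) h
      have e2 := congrArg (fun v : E3 => v 2) h
      simp at e0 e1 e2
      have hs : s = 0 := by
        by_contra hs
        exact hab ⟨e0.resolve_left hs, e1.resolve_left hs⟩
      refine ⟨hs, ?_⟩
      rw [hs] at e2
      linarith
    have := finrank_exposedFace_le_one (r := levelZ i) hind fun j n hj => by
      rw [inner_vertical rfl rfl, spiralPoint_apply_two, hlev j n hj]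
      simp
    omega
  have hj0 : j ≠ 0 := ((Fin.zero_le i).trans_lt hij).ne'
  have hmax := pentVal_le_of_mem_exposedFace hj0 hj
  have hp := pentVal_pos_of_max hab hmax
  -- two copies are touched
  obtain ⟨j', n', hj'0, hn', hj'⟩ : ∃ j' n', j' ≠ 0 ∧ n' ≠ n ∧
      spiralPoint j' n' ∈ exposedFace u := by
    by_contra! hno
    -- With only copy `n` touched, the face lies in the vertical plane through the axis and that
    -- copy, which is transverse to `u`.
    have hind : LinearIndependent ℝ ![u, !₂[-pentS n, pentC n, 0]] := by
      rw [LinearIndependent.pair_iff]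
      intro s t h
      have e0 := congrArg (fun v : E3 => v 0) h
      have e1 := congrArg (fun v : E3 => v 1) h
      simp only [PiLp.add_apply, PiLp.smul_apply, PiLp.zero_apply, smul_eq_mul,
        Matrix.cons_val] at e0 e1
      have hsq := pentC_sq_add_pentS_sq n
      have hs : s = 0 := by
        have : s * pentVal (u 0) (u 1) n = 0 := by
          rw [pentVal]
          linear_combination pentC n * e0 + pentS n * e1
        exact (mul_eq_zero.1 this).resolve_right hp.ne'
      refine ⟨hs, ?_⟩
      rw [hs] at e0 e1
      linear_combination pentC n * e1 - pentS n * e0 - t * hsq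
    have := finrank_exposedFace_le_one (r := 0) hind fun i' m' hi' => by
      by_cases hi'0 : i' = 0
      · rw [hi'0, inner_spiralPoint, levelX_zero]
        simp
      · have hm' : m' = n := by
          by_contra hm'
          exact hno i' m' hi'0 hm' hi'
        rw [inner_spiralPoint, hm', pentVal]
        simp only [Matrix.cons_val]
        ring
    omega
  obtain ⟨k, t, ht, ha, hb⟩ := exists_side_of_max hab hn'.symm hmax
    (le_antisymm (hmax n') (pentVal_le_of_mem_exposedFace hj'0 hj' n))
  set p := pentVal (u 0) (u 1) n with hpdef
  have hscale : ∀ r, pentVal (u 0) (u 1) r = t * pentVal (sideC k) (sideS k) r := by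
    intro r
    rw [pentVal, pentVal, ha, hb]; ring
  have hpt : p = t * (cos (π / 5) + 1 / 2) := by
    apply le_antisymm
    · rw [hpdef, hscale]
      exact mul_le_mul_of_nonneg_left (pentVal_side_le k n) ht.le
    · rw [← pentVal_side_left k, ← hscale]
      exact hmax k
  have hval : ∀ r, inner ℝ u (spiralPoint r n) =
      p / cos (π / 5) * levelX r + u 2 * levelZ r := by
    intro r
    rw [inner_spiralPoint, ← hpdef]; ring
  -- The upper touched level may be met in another copy; at the top the copies coincide, and below
  -- it both copies maximise the same horizontal functional.
  have hi' : spiralPoint i n ∈ exposedFace u := by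
    by_cases hi0 : i = 0
    · rw [hi0, spiralPoint_zero n, ← spiralPoint_zero m, ← hi0]
      exact hi
    · have he : inner ℝ u (spiralPoint i n) = inner ℝ u (spiralPoint i m) := by
        rw [inner_spiralPoint, inner_spiralPoint,
          le_antisymm (hmax m) (pentVal_le_of_mem_exposedFace hi0 hi n)]
      exact ⟨spiralPoint_mem i n, fun y hy => he ▸ hi.2 y hy⟩
  obtain ⟨l, s, hs, h1, h2⟩ := exists_level_normal_of_max (div_pos hp hκ) hij
    (fun r => by rw [← hval, ← hval]; exact hi'.2 _ (spiralPoint_mem r n))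
    (by rw [← hval, ← hval]; exact inner_eq_of_mem_exposedFace hj hi')
  -- The horizontal maximum p computed from the pentagon side is 2κ²t, and from the profile side it
  -- is κ times s times the height difference.
  have ht' : t = s / (2 * cos (π / 5)) * (levelZ l.castSucc - levelZ l.succ) := by
    rw [hpt, div_eq_iff hκ.ne'] at h1
    have hk := four_mul_cos_pi_div_five_sq
    field_simp
    have : (t * (2 * cos (π / 5))) * cos (π / 5) =
        (s * (levelZ l.castSucc - levelZ l.succ)) * cos (π / 5) := by
      linear_combination h1 + t / 2 * hk
    have := mul_right_cancel₀ hκ.ne' this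
    linarith
  have hu : u = (s / (2 * cos (π / 5))) • faceNormal (some (l, k)) := by
    apply E3_ext
    · simp only [PiLp.smul_apply, faceNormal, Matrix.cons_val, smul_eq_mul]
      rw [ha, ht']; ring
    · simp only [PiLp.smul_apply, faceNormal, Matrix.cons_val, smul_eq_mul]
      rw [hb, ht']; ring
    · simp only [PiLp.smul_apply, faceNormal, Matrix.cons_val, smul_eq_mul]
      rw [h2]; field_simp
  exact ⟨some (l, k), by rw [hu, exposedFace_smul (by positivity)]⟩

lemma faces_spiral : faces spiral = Set.range fun d => exposedFace (faceNormal d) := by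
  ext F
  constructor
  · rintro ⟨hexp, hdim⟩
    have hne : F.Nonempty := by
      by_contra! hemp
      rw [hemp, vectorSpan_empty, finrank_bot] at hdim
      omega
    obtain ⟨f, hf⟩ := hexp hne
    have hF : F = exposedFace ((InnerProductSpace.toDual ℝ E3).symm f) := by
      simp only [exposedFace, InnerProductSpace.toDual_symm_apply]
      exact hf
    rw [hF] at hdim
    obtain ⟨d, hd⟩ := exists_faceNormal_of_finrank hdim
    exact ⟨d, by rw [hF, hd]⟩
  · rintro ⟨d, rfl⟩
    exact ⟨fun _ => ⟨innerSL ℝ (faceNormal d), rfl⟩, finrank_faceNormal d⟩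

lemma numFaces_spiral : numFaces spiral = 21 := by
  rw [numFaces, faces_spiral, ← Set.image_univ,
    (injective_exposedFace_faceNormal.injOn).ncard_image, Set.ncard_univ]
  simp

/-! ### Counting equilibria and the minima -/

lemma isStable_iff {q : E3} : IsStable spiral center q ↔ q = bottom := by
  constructor
  · rintro ⟨h, hdim⟩
    refine (eq_top_or_bottom h.1).resolve_left ?_
    rintro rfl
    rw [contactSet_top, vectorSpan_singleton, finrank_bot] at hdim
    omega
  · rintro rfl
    refine ⟨isNondegenerateEquilibrium_bottom, ?_⟩
    have : exposedFace (bottom - center) = exposedFace (faceNormal none) := by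
      ext x
      rw [mem_exposedFace_bottom_sub_center, mem_exposedFace_bottomNormal]
    rw [contactSet_bottom, this, finrank_bottomFace]

lemma isUnstable_iff {q : E3} : IsUnstable spiral center q ↔ q = spiralPoint 0 0 := by
  constructor
  · rintro ⟨h, hdim⟩
    refine (eq_top_or_bottom h.1).resolve_right ?_
    rintro rfl
    rw [(isStable_iff.2 rfl).2] at hdim
    omega
  · rintro rfl
    refine ⟨isNondegenerateEquilibrium_top, ?_⟩
    rw [contactSet_top, vectorSpan_singleton, finrank_bot]

lemma numStable_spiral : numStable spiral = 1 := by
  simp only [numStable, centerOfMass_spiral, isStable_iff]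
  exact Set.ncard_singleton _

lemma numUnstable_spiral : numUnstable spiral = 1 := by
  simp only [numUnstable, centerOfMass_spiral, isUnstable_iff]
  exact Set.ncard_singleton _

lemma isMonoMonostatic_spiral : IsMonoMonostatic spiral := by
  refine ⟨isConvexPolyhedron_spiral, fun q hq => ?_, numStable_spiral, numUnstable_spiral⟩
  rw [centerOfMass_spiral] at hq ⊢
  rcases eq_top_or_bottom hq with rfl | rfl
  · exact isNondegenerateEquilibrium_top
  · exact isNondegenerateEquilibrium_bottom

lemma complexity_spiral : complexity spiral = 80 := by
  rw [complexity, numVertices_spiral, numFaces_spiral, numStable_spiral, numUnstable_spiral]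
  norm_num

/-- Complexities are integers, so the existence of the minimum needs a lower bound; with S and U
fixed, nonnegativity of the vertex and face numbers suffices. -/
lemma bddBelow_classComplexities (S U : ℕ) : BddBelow (classComplexities S U) := by
  refine ⟨-2 * (S + U), ?_⟩
  rintro _ ⟨P, ⟨-, -, hS, hU⟩, rfl⟩
  rw [complexity, hS, hU]
  have : (0 : ℤ) ≤ numVertices P := Int.natCast_nonneg _
  have : (0 : ℤ) ≤ numFaces P := Int.natCast_nonneg _
  linarith

end ZeroSkeleton

theorem theorem1 :
    -- the explicit Conway 5-spiral is a mono-monostatic 0-skeleton with 21 vertices and 21 faces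
    (ZeroSkeleton.IsMonoMonostatic (ZeroSkeleton.conwaySpiral 4 5 ZeroSkeleton.tableAngle) ∧
      ZeroSkeleton.numVertices (ZeroSkeleton.conwaySpiral 4 5 ZeroSkeleton.tableAngle) = 21 ∧
      ZeroSkeleton.numFaces (ZeroSkeleton.conwaySpiral 4 5 ZeroSkeleton.tableAngle) = 21) ∧
    -- the minimal face and vertex numbers exist and are at most 21
    (IsLeast ZeroSkeleton.monoMonostaticFaceNumbers ZeroSkeleton.minFaces ∧
      ZeroSkeleton.minFaces ≤ 21) ∧
    (IsLeast ZeroSkeleton.monoMonostaticVertexNumbers ZeroSkeleton.minVertices ∧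
      ZeroSkeleton.minVertices ≤ 21) ∧
    -- the minimal complexity of the class (1, 1) exists and is at most 80
    (IsLeast (ZeroSkeleton.classComplexities 1 1) (ZeroSkeleton.classComplexity 1 1) ∧
      ZeroSkeleton.classComplexity 1 1 ≤ 80) := by
  rw [ZeroSkeleton.conwaySpiral_eq_spiral]
  have hP := ZeroSkeleton.isMonoMonostatic_spiral
  have hF : 21 ∈ ZeroSkeleton.monoMonostaticFaceNumbers := ⟨_, hP, ZeroSkeleton.numFaces_spiral⟩
  have hV : 21 ∈ ZeroSkeleton.monoMonostaticVertexNumbers :=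
    ⟨_, hP, ZeroSkeleton.numVertices_spiral⟩
  have hC : 80 ∈ ZeroSkeleton.classComplexities 1 1 := ⟨_, hP, ZeroSkeleton.complexity_spiral⟩
  have hB := ZeroSkeleton.bddBelow_classComplexities 1 1
  exact ⟨⟨hP, ZeroSkeleton.numVertices_spiral, ZeroSkeleton.numFaces_spiral⟩,
    ⟨⟨Nat.sInf_mem ⟨_, hF⟩, fun _ h => Nat.sInf_le h⟩, Nat.sInf_le hF⟩,
    ⟨⟨Nat.sInf_mem ⟨_, hV⟩, fun _ h => Nat.sInf_le h⟩, Nat.sInf_le hV⟩,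
    ⟨⟨Int.csInf_mem ⟨_, hC⟩ hB, fun _ h => csInf_le hB h⟩, csInf_le hB hC⟩⟩
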